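/- Let $d,k,t\ge 1$ and $q\ge 2$ be integers with $k(q-1)>dt+d+q-1$. A measurable $k$-coloring of $\mathbb{R}^d$ is a map $f:\mathbb{R}^d\to\{1,\dots,k\}$ all of whose color classes $f^{-1}(j)$ are Lebesgue measurable. A necklace is a nontrivial axis-aligned cube $C=[\alpha_1,\alpha_1+\alpha_0]\times\dots\times[\alpha_d,\alpha_d+\alpha_0]$ with $\alpha_0>0$. A fair $q$-splitting of $C$ using at most $t$ arbitrary hyperplane cuts consists of at most $t$ affine hyperplanes of $\mathbb{R}^d$ (not necessarily axis-aligned) together with a labeling, by $q$ labels, of the pieces into which they divide $C$, such that for every color $j$ and every label $l$ the union of the pieces labeled $l$ contains exactly $1/q$ of the Lebesgue measure of $C\cap f^{-1}(j)$. Then there is a measurable $k$-coloring of $\mathbb{R}^d$ such that no necklace has a fair $q$-splitting using at most $t$ arbitrary hyperplane cuts. Moreover, the set of such colorings is dense in the metric space of all measurable $k$-colorings of $\mathbb{R}^d$ with the distance $$d(f,g)=\sum_{n=1}^{\infty}\frac{1}{2^n}\cdot\frac{\mathcal{L}(\{x\in[-n,n]^d: f(x)\ne g(x)\})}{(2n)^d},$$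 where $\mathcal{L}$ is Lebesgue measure and colorings at distance zero (those equal almost everywhere) are identified. -/

import Mathlib

open MeasureTheory

/-- A measurable `k`-coloring of `ℝ^d`: every color class is Lebesgue measurable
(`NullMeasurableSet` for `volume`, i.e. measurable for the completed measure). -/
structure MeasurableColoring (d k : ℕ) where
  /-- the color of each point -/
  color : (Fin d → ℝ) → Fin k
  lebesgueMeasurable : ∀ j : Fin k, NullMeasurableSet (color ⁻¹' {j}) volume

namespace MeasurableColoring

variable {d k : ℕ}

/-- The axis-aligned cube `[α₁, α₁ + r] × ⋯ × [α_d, α_d + r]`, nontrivial when `0 < r`. -/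
def cube (α : Fin d → ℝ) (r : ℝ) : Set (Fin d → ℝ) :=
  Set.Icc α (fun i => α i + r)

/-- `D_n(f, g)`: the points of `[-n, n]^d` at which `f` and `g` differ. -/
def diffSet (f g : MeasurableColoring d k) (n : ℕ) : Set (Fin d → ℝ) :=
  {x | x ∈ Set.Icc (fun _ => -(n : ℝ)) (fun _ => (n : ℝ)) ∧ f.color x ≠ g.color x}

/-- `d_n(f, g)`: the normalized distance of `f` and `g` on `[-n, n]^d`. -/
noncomputable def normDist (f g : MeasurableColoring d k) (n : ℕ) : ℝ :=
  volume.real (diffSet f g n) / (2 * (n : ℝ)) ^ d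

/-- `d(f, g) = ∑_{n ≥ 1} d_n(f, g) / 2^n`. -/
noncomputable def colorDist (f g : MeasurableColoring d k) : ℝ :=
  ∑' n : ℕ, normDist f g (n + 1) / 2 ^ (n + 1)

theorem volume_box (n : ℕ) :
    volume (Set.Icc (fun _ : Fin d => -(n : ℝ)) (fun _ => (n : ℝ)))
      = ENNReal.ofReal ((2 * (n : ℝ)) ^ d) := by
  rw [Real.volume_Icc_pi]
  simp only [Finset.prod_const, Finset.card_univ, Fintype.card_fin]
  rw [ENNReal.ofReal_pow (by positivity)]
  congr 2
  ring

theorem volume_diffSet_ne_top (f g : MeasurableColoring d k) (n : ℕ) :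
    volume (diffSet f g n) ≠ ⊤ := by
  refine ne_top_of_le_ne_top ?_ (measure_mono (fun x hx => hx.1))
  rw [volume_box]
  exact ENNReal.ofReal_ne_top

theorem normDist_nonneg (f g : MeasurableColoring d k) (n : ℕ) : 0 ≤ normDist f g n := by
  unfold normDist
  positivity

theorem normDist_le_one (f g : MeasurableColoring d k) (n : ℕ) : normDist f g n ≤ 1 := by
  unfold normDist
  refine div_le_one_of_le₀ ?_ (by positivity)
  refine ENNReal.toReal_le_of_le_ofReal (by positivity) ?_
  rw [← volume_box]
  exact measure_mono (fun x hx => hx.1)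

theorem normDist_triangle (f g h : MeasurableColoring d k) (n : ℕ) :
    normDist f h n ≤ normDist f g n + normDist g h n := by
  unfold normDist
  rw [← add_div]
  refine div_le_div_of_nonneg_right ?_ (by positivity)
  have hsub : diffSet f h n ⊆ diffSet f g n ∪ diffSet g h n := by
    rintro x ⟨hx, hne⟩
    by_cases hfg : f.color x = g.color x
    · exact Or.inr ⟨hx, fun e => hne (hfg.trans e)⟩
    · exact Or.inl ⟨hx, hfg⟩
  refine le_trans (measureReal_mono hsub ?_) (measureReal_union_le _ _)
  exact measure_union_ne_top (volume_diffSet_ne_top f g n) (volume_diffSet_ne_top g h n)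

theorem summable_normDist (f g : MeasurableColoring d k) :
    Summable (fun n : ℕ => normDist f g (n + 1) / 2 ^ (n + 1)) := by
  have hs : Summable (fun n : ℕ => (1 / 2 : ℝ) ^ (n + 1)) :=
    (summable_nat_add_iff 1).2 summable_geometric_two
  refine Summable.of_nonneg_of_le
    (fun n => div_nonneg (normDist_nonneg f g _) (by positivity)) (fun n => ?_) hs
  rw [one_div, inv_pow, ← one_div]
  exact div_le_div_of_nonneg_right (normDist_le_one f g _) (by positivity)

noncomputable instance : PseudoMetricSpace (MeasurableColoring d k) where
  dist := colorDist
  dist_self f := by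
    simp [colorDist, normDist, diffSet]
  dist_comm f g := by
    simp only [colorDist, normDist, diffSet, ne_comm]
  dist_triangle f g h := by
    unfold colorDist
    rw [← (summable_normDist f g).tsum_add (summable_normDist g h)]
    refine (summable_normDist f h).tsum_le_tsum (fun n => ?_)
      ((summable_normDist f g).add (summable_normDist g h))
    rw [← add_div]
    exact div_le_div_of_nonneg_right (normDist_triangle f g h _) (by positivity)

end MeasurableColoring

/-- The metric space of measurable `k`-colorings of `ℝ^d`, where colorings at distance zero
are identified. -/
abbrev ColoringSpace (d k : ℕ) : Type :=
  SeparationQuotient (MeasurableColoring d k)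

/-- The piece cut out of `C` by the hyperplanes `{x | v i ⬝ᵥ x = b i}` that lies on the sides
prescribed by `σ`. The nonempty ones among these sets are the pieces of the division of `C`
(for a cube `C`, the connected components of `C` minus the hyperplanes). -/
def hyperplanePiece {d s : ℕ} (C : Set (Fin d → ℝ)) (v : Fin s → Fin d → ℝ) (b : Fin s → ℝ)
    (σ : Fin s → Bool) : Set (Fin d → ℝ) :=
  {x | x ∈ C ∧ ∀ i, if σ i = true then b i < v i ⬝ᵥ x else v i ⬝ᵥ x < b i}

namespace MeasurableColoring

/-- The set `C`, colored by `f`, has a fair `q`-splitting using at most `t` arbitrary hyperplane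
cuts: for some `s ≤ t` hyperplanes `{x | v i ⬝ᵥ x = b i}`, `v i ≠ 0`, the pieces of the division
of `C` can be labeled with `q` labels so that, for every color `j` and every label `l`, the
union of the pieces labeled `l` contains exactly `1/q` of the measure of the color `j` in `C`. -/
def HasFairSplitting {d k : ℕ} (f : MeasurableColoring d k) (q t : ℕ)
    (C : Set (Fin d → ℝ)) : Prop :=
  ∃ s : ℕ, s ≤ t ∧ ∃ (v : Fin s → Fin d → ℝ) (b : Fin s → ℝ),
    (∀ i, v i ≠ 0) ∧ ∃ label : (Fin s → Bool) → Fin q,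
      ∀ (j : Fin k) (l : Fin q),
        volume ((⋃ σ ∈ {σ | label σ = l}, hyperplanePiece C v b σ) ∩ f.color ⁻¹' {j})
          = volume (C ∩ f.color ⁻¹' {j}) / (q : ENNReal)

/-- No necklace (nontrivial axis-aligned cube) colored by `f` has a fair `q`-splitting using at
most `t` arbitrary hyperplane cuts. -/
def AvoidsFairSplitting {d k : ℕ} (f : MeasurableColoring d k) (q t : ℕ) : Prop :=
  ∀ (α : Fin d → ℝ) (r : ℝ), 0 < r → ¬ f.HasFairSplitting q t (cube α r)

end MeasurableColoring

/-!
A fair splitting of a cube imposes `k * (q - 1)` conditions, while a cube and `t` hyperplanes have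
only `d * t + d + 1` degrees of freedom, so for a generic coloring there should be no solution. The
proof makes the coloring generic by recoloring a given coloring `g` on a small set.

**Recoloring.** Write `k = K + 1` and `q = Q + 1`. A countable family of disjoint cells of small
total volume is chosen such that every nonempty open set contains, for each of the first `K`
colors, a cell reserved for that color (`CellSystem.exists_subset_of_isOpen`). A real parameter per
cell prescribes which proportion of the cell gets the reserved color; the rest of the cell gets the
last color. All these recolorings are close to `g` (`CellSystem.dist_recolor_le`), and their
parameters range over the Baire space `ℕ × Fin K → ℝ`.

**Counting.** A cube and its hyperplanes are encoded by `p : Param d t`, and a fair splitting makes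
`p` balanced: all labels get the same amount of each color (`HasFairSplitting.exists_balanced`).
Near a given `p₀` at which every label has positive volume, each label but the first contains `K`
fixed cells, one for each of the first `K` colors. The recoloring of these `Q * K` cells changes
the amounts by terms that do not depend on `p`, so if `p` is balanced, then the vector of
these `Q * K` amounts equals `Φ p`, where `Φ` depends only on the other cells. The function `Φ` is
Lipschitz because the volumes of the regions are (`Param.exists_lipschitz_region`). Now
`Q * K ≥ d * t + d + 1`, and a balanced `p` satisfies one more equation that does not involve the
coloring: the first label gets the share `1 / q` of the volume of the cube. This restricts `p` to a
null set (`Param.volume_setOf_region_share_eq_zero`), whose image under `Φ` is null. Hence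
parameters with a balanced `p` near `p₀` form a closed set without interior points
(`Param.isClosed_badRecolorings`, `Param.interior_badRecolorings_eq_empty`), and by the theorems
of Lindelöf and Baire some recoloring has no balanced `p` at all.

**The share is generic.** If the hyperplanes are scaled along the coordinate axes by
`c ∈ (0, ∞)^d`, the unit cube may be replaced by the box `[0, c]`. The mixed derivative in `c` of
`vol ([0, c] ∩ A) - vol [0, c] / q` is the indicator function of `A` minus `1 / q`, which never
vanishes, so that this difference itself vanishes only on a null set
(`ae_eq_zero_of_setIntegral_Icc_eq_zero`).
-/

/-! ### Integrals over boxes -/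

/-- The zeros of `f` at which `f` has a nonzero derivative are isolated, so a primitive of `g`
vanishes, up to a null set, only where `g` does. -/
theorem ae_eq_zero_of_intervalIntegral_eq_zero {g : ℝ → ℝ} (hg : LocallyIntegrable g volume) :
    ∀ᵐ s, (∫ u in (0 : ℝ)..s, g u) = 0 → g s = 0 := by
  set S : Set ℝ := {s | HasDerivAt (fun x => ∫ u in (0 : ℝ)..x, g u) (g s) s ∧
    (∫ u in (0 : ℝ)..s, g u) = 0 ∧ g s ≠ 0} with hS
  have hcount : S.Countable := by
    have hloc : ∀ x ∈ S, {x} ∈ nhdsWithin x S := by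
      rintro x ⟨hd, -, hne⟩
      have h1 := hd.eventually_ne (c := 0) hne
      rw [eventually_nhdsWithin_iff] at h1
      rw [mem_nhdsWithin_iff_eventually]
      filter_upwards [h1] with y hy hyS
      by_contra hyx
      exact hy hyx hyS.2.1
    obtain ⟨T, -, hT, hcov⟩ := TopologicalSpace.countable_cover_nhdsWithin hloc
    refine hT.mono fun x hx => ?_
    simpa using hcov hx
  filter_upwards [_root_.LocallyIntegrable.ae_hasDerivAt_integral hg,
    hcount.ae_notMem volume] with s hs hsS h0
  by_contra hne
  exact hsS ⟨hs 0, h0, hne⟩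

theorem ae_prod_of_ae_right {X Y : Type*} [MeasurableSpace X] [MeasurableSpace Y]
    {μ : Measure X} {ν : Measure Y} [SFinite μ] [SFinite ν] {p : X × Y → Prop}
    (hp : MeasurableSet {z | p z}) (h : ∀ x, ∀ᵐ y ∂ν, p (x, y)) : ∀ᵐ z ∂(μ.prod ν), p z :=
  (Measure.measure_prod_null hp.compl).2 (Filter.Eventually.of_forall fun x => h x)

theorem ae_prod_of_ae_left {X Y : Type*} [MeasurableSpace X] [MeasurableSpace Y]
    {μ : Measure X} {ν : Measure Y} [SFinite μ] [SFinite ν] {p : X × Y → Prop}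
    (hp : MeasurableSet {z | p z}) (h : ∀ y, ∀ᵐ x ∂μ, p (x, y)) : ∀ᵐ z ∂(μ.prod ν), p z := by
  have := ae_prod_of_ae_right (μ := ν) (ν := μ) (p := fun z => p z.swap)
    (measurable_swap hp) h
  rw [← Measure.prod_swap]
  exact (ae_map_iff measurable_swap.aemeasurable hp).2 this

theorem measurable_setIntegral_Icc {X : Type*} [MeasurableSpace X] {n : ℕ}
    {g : X × (Fin n → ℝ) → ℝ} (hg : Measurable g) :
    Measurable fun z : X × (Fin n → ℝ) => ∫ y in Set.Icc 0 z.2, g (z.1, y) := by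
  have hset : MeasurableSet {w : (X × (Fin n → ℝ)) × (Fin n → ℝ) | w.2 ∈ Set.Icc 0 w.1.2} :=
    (measurableSet_le measurable_const measurable_snd).inter
      (measurableSet_le measurable_snd measurable_fst.snd)
  have h1 : StronglyMeasurable fun w : (X × (Fin n → ℝ)) × (Fin n → ℝ) =>
      Set.indicator {w | w.2 ∈ Set.Icc 0 w.1.2} (fun w => g (w.1.1, w.2)) w :=
    ((hg.comp (measurable_fst.fst.prodMk measurable_snd)).indicator hset).stronglyMeasurable
  have h2 := (h1.integral_prod_right' (ν := (volume : Measure (Fin n → ℝ)))).measurable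
  simp_rw [← integral_indicator measurableSet_Icc]
  exact h2

/-- Almost every corner `c` for which the integral of `g` over the box `[0, c]` vanishes is a zero
of `g`: the mixed partial derivative of that integral is `g`. -/
theorem ae_eq_zero_of_setIntegral_Icc_eq_zero {d : ℕ} {g : (Fin d → ℝ) → ℝ} (hg : Measurable g)
    {M : ℝ} (hM : ∀ x, |g x| ≤ M) :
    ∀ᵐ c : Fin d → ℝ, (∀ i, 0 < c i) → (∫ y in Set.Icc 0 c, g y) = 0 → g c = 0 := by
  induction d with
  | zero =>
    refine Filter.Eventually.of_forall fun c _ h => ?_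
    have hc : Set.Icc 0 c = Set.univ := by
      ext y; simp [Subsingleton.elim y 0, Subsingleton.elim c 0]
    rw [hc, Measure.restrict_univ, integral_unique] at h
    have hone : volume.real (Set.univ : Set (Fin 0 → ℝ)) = 1 := by
      simp [Measure.real, volume_pi]
    rw [hone, one_smul] at h
    rwa [Subsingleton.elim c (@default _ Unique.instInhabited)]
  | succ n ih =>
    set e := MeasurableEquiv.piFinSuccAbove (fun _ : Fin (n + 1) => ℝ) 0 with he
    have hmp : MeasurePreserving e volume (volume.prod volume) :=
      volume_preserving_piFinSuccAbove (fun _ : Fin (n + 1) => ℝ) 0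
    set f : ℝ × (Fin n → ℝ) → ℝ := fun z => g (e.symm z) with hf
    have hfm : Measurable f := hg.comp e.symm.measurable
    have hfM : ∀ z, |f z| ≤ M := fun z => hM _
    -- `G` is the integral over the last coordinates only; it is integrated over the first one next
    set G : ℝ × (Fin n → ℝ) → ℝ := fun z => ∫ y in Set.Icc 0 z.2, f (z.1, y) with hG
    have hGm : Measurable G := measurable_setIntegral_Icc hfm
    have hGb : ∀ u y, |G (u, y)| ≤ M * volume.real (Set.Icc (0 : Fin n → ℝ) y) := fun u y =>
      norm_setIntegral_le_of_norm_le_const (f := fun z => f (u, z))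
        isCompact_Icc.measure_lt_top fun z _ => hfM (u, z)
    have hGint : ∀ y, LocallyIntegrable (fun u => G (u, y)) volume := fun y => by
      have hmeas : Measurable fun u => G (u, y) := hGm.comp measurable_prodMk_right
      exact (locallyIntegrable_const (M * volume.real (Set.Icc (0 : Fin n → ℝ) y))).mono
        hmeas.aestronglyMeasurable
        (Filter.Eventually.of_forall fun u => (hGb u y).trans (le_abs_self _))
    have hFm : Measurable fun z : ℝ × (Fin n → ℝ) => ∫ u in (0 : ℝ)..z.1, G (u, z.2) := by
      have hset : ∀ a b : (ℝ × (Fin n → ℝ)) → ℝ, Measurable a → Measurable b →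
          Measurable fun z => ∫ u in Set.Ioc (a z) (b z), G (u, z.2) := by
        intro a b ha hb
        have hs : MeasurableSet {w : (ℝ × (Fin n → ℝ)) × ℝ | w.2 ∈ Set.Ioc (a w.1) (b w.1)} :=
          (measurableSet_lt (ha.comp measurable_fst) measurable_snd).inter
            (measurableSet_le measurable_snd (hb.comp measurable_fst))
        have h1 : StronglyMeasurable fun w : (ℝ × (Fin n → ℝ)) × ℝ =>
            Set.indicator {w | w.2 ∈ Set.Ioc (a w.1) (b w.1)} (fun w => G (w.2, w.1.2)) w :=
          ((hGm.comp (measurable_snd.prodMk measurable_fst.snd)).indicator hs).stronglyMeasurable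
        have h2 := (h1.integral_prod_right' (ν := (volume : Measure ℝ))).measurable
        simp_rw [← integral_indicator measurableSet_Ioc]
        exact h2
      exact (hset _ _ measurable_const measurable_fst).sub
        (hset _ _ measurable_fst measurable_const)
    have step1 : ∀ᵐ z : ℝ × (Fin n → ℝ) ∂(volume.prod volume),
        (∫ u in (0 : ℝ)..z.1, G (u, z.2)) = 0 → G z = 0 := by
      refine ae_prod_of_ae_left ?_ fun y => ae_eq_zero_of_intervalIntegral_eq_zero (hGint y)
      exact (measurableSet_eq_fun hFm measurable_const).himp
        (measurableSet_eq_fun hGm measurable_const)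
    have step2 : ∀ᵐ z : ℝ × (Fin n → ℝ) ∂(volume.prod volume),
        (∀ i, 0 < z.2 i) → G z = 0 → f z = 0 := by
      refine ae_prod_of_ae_right ?_ fun u =>
        ih (g := fun y => f (u, y)) (hfm.comp measurable_prodMk_left) fun y => hfM (u, y)
      have hpos : MeasurableSet {z : ℝ × (Fin n → ℝ) | ∀ i, 0 < z.2 i} := by
        rw [Set.ofPred_forall]
        exact MeasurableSet.iInter fun i =>
          measurableSet_lt measurable_const ((measurable_pi_apply i).comp measurable_snd)
      exact hpos.himp ((measurableSet_eq_fun hGm measurable_const).himp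
        (measurableSet_eq_fun hfm measurable_const))
    filter_upwards [hmp.quasiMeasurePreserving.ae step1, hmp.quasiMeasurePreserving.ae step2]
      with c h1 h2 hpos h0
    have hec : e c = (c 0, fun i => c i.succ) := by
      ext <;> simp [he, MeasurableEquiv.piFinSuccAbove, Fin.insertNthEquiv, Fin.tail]
    have hfe : f (e c) = g c := by simp [hf]
    rw [← hfe]
    refine h2 (fun i => by rw [hec]; exact hpos _) (h1 ?_)
    have hpre : Set.Icc 0 c = e ⁻¹' (Set.Icc 0 (e c).1 ×ˢ Set.Icc 0 (e c).2) := by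
      ext y
      have hey : e y = (y 0, fun i => y i.succ) := by
        ext <;> simp [he, MeasurableEquiv.piFinSuccAbove, Fin.insertNthEquiv, Fin.tail]
      simp only [Set.mem_preimage, Set.mem_prod, hec, hey, Set.mem_Icc, Pi.le_def,
        Fin.forall_fin_succ, Pi.zero_apply]
      tauto
    have hgf : ∀ y, g y = f (e y) := fun y => by simp [hf]
    rw [hpre] at h0
    simp_rw [hgf] at h0
    rw [hmp.setIntegral_preimage_emb e.measurableEmbedding,
      setIntegral_prod] at h0
    · rw [intervalIntegral.integral_of_le (by rw [hec]; exact (hpos 0).le),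
        ← integral_Icc_eq_integral_Ioc]
      exact h0
    · refine Measure.integrableOn_of_bounded (M := M) ?_ hfm.aestronglyMeasurable
        (Filter.Eventually.of_forall hfM)
      exact (isCompact_Icc.prod isCompact_Icc).measure_lt_top.ne

/-! ### Slabs and disjoint cells -/

/-- The part of the slab `|w ⬝ x - b| ≤ δ` inside the box `[-M, M]^d` has volume `O(δ)`, uniformly
in `b` and in those `w` with a coordinate bounded away from zero: replacing that coordinate of `x`
by `w ⬝ x` is a linear map with determinant `w j`. -/
theorem volume_slab_le {d : ℕ} {w : Fin d → ℝ} {j : Fin d} {c M δ : ℝ} (b : ℝ) (hc : 0 < c)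
    (hw : c ≤ |w j|) (hδ : 0 ≤ δ) (hM : 0 ≤ M) :
    volume {x : Fin d → ℝ | (∀ i, |x i| ≤ M) ∧ |∑ i, w i * x i - b| ≤ δ} ≤
      ENNReal.ofReal (2 * (2 * M) ^ (d - 1) / c * δ) := by
  set S := {x : Fin d → ℝ | (∀ i, |x i| ≤ M) ∧ |∑ i, w i * x i - b| ≤ δ} with hS
  set T : (Fin d → ℝ) →ₗ[ℝ] (Fin d → ℝ) :=
    Matrix.toLin' ((1 : Matrix (Fin d) (Fin d) ℝ).updateRow j w) with hT
  have hdet : LinearMap.det T = w j := by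
    rw [hT, LinearMap.det_toLin', ← Matrix.cramer_transpose_apply, Matrix.transpose_one,
      Matrix.cramer_one]
    rfl
  have hTj : ∀ x, T x j = ∑ i, w i * x i := fun x => by
    simp [hT, Matrix.toLin'_apply, Matrix.mulVec, dotProduct]
  have hTi : ∀ x i, i ≠ j → T x i = x i := fun x i hij => by
    rw [hT, Matrix.toLin'_apply, Matrix.mulVec, Matrix.updateRow_ne hij]
    simp [dotProduct, Matrix.one_apply]
  have himg : T '' S ⊆ Set.Icc (Function.update (fun _ => -M) j (b - δ))
      (Function.update (fun _ => M) j (b + δ)) := by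
    rintro _ ⟨x, ⟨hx, hxb⟩, rfl⟩
    rw [abs_le] at hxb
    constructor <;> intro i <;> by_cases hij : i = j
    · subst hij; rw [hTj, Function.update_self]; linarith
    · rw [hTi x i hij, Function.update_of_ne hij]; exact (abs_le.1 (hx i)).1
    · subst hij; rw [hTj, Function.update_self]; linarith
    · rw [hTi x i hij, Function.update_of_ne hij]; exact (abs_le.1 (hx i)).2
  have hvol : volume (T '' S) ≤ ENNReal.ofReal (2 * δ * (2 * M) ^ (d - 1)) := by
    refine (measure_mono himg).trans (le_of_eq ?_)
    rw [Real.volume_Icc_pi, ← ENNReal.ofReal_prod_of_nonneg]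
    · congr 1
      rw [← Finset.mul_prod_erase _ _ (Finset.mem_univ j)]
      congr 1
      · simp only [Function.update_self]; ring
      · rw [Finset.prod_congr rfl (g := fun _ => 2 * M), Finset.prod_const,
          Finset.card_erase_of_mem (Finset.mem_univ j), Finset.card_univ, Fintype.card_fin]
        intro i hi
        rw [Function.update_of_ne (Finset.ne_of_mem_erase hi),
          Function.update_of_ne (Finset.ne_of_mem_erase hi)]
        ring
    · intro i _
      by_cases hij : i = j
      · subst hij; simp only [Function.update_self]; linarith
      · rw [Function.update_of_ne hij, Function.update_of_ne hij]; linarith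
  rw [Measure.addHaar_image_linearMap, hdet] at hvol
  have h1 : volume S * ENNReal.ofReal c ≤ ENNReal.ofReal (2 * δ * (2 * M) ^ (d - 1)) := by
    rw [mul_comm]
    exact (mul_le_mul_left (ENNReal.ofReal_le_ofReal hw) _).trans hvol
  rw [← ENNReal.le_div_iff_mul_le (Or.inl (by simpa using hc)) (Or.inl ENNReal.ofReal_ne_top),
    ← ENNReal.ofReal_div_of_pos hc] at h1
  refine h1.trans (le_of_eq ?_)
  congr 1
  ring

/-- A bounded set can be cut by a hyperplane orthogonal to a given coordinate axis in any
prescribed proportion. -/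
theorem exists_volume_inter_lt_eq {d : ℕ} (j : Fin d) {S : Set (Fin d → ℝ)} {M : ℝ} (hM : 0 ≤ M)
    (hS : ∀ x ∈ S, ∀ i, |x i| ≤ M) {u : ℝ} (hu : u ∈ Set.Icc 0 (volume.real S)) :
    ∃ τ : ℝ, volume.real (S ∩ {x | x j < τ}) = u := by
  have hSfin : volume S ≠ ⊤ := by
    refine ne_top_of_le_ne_top (isCompact_Icc (a := fun _ : Fin d => -M)
      (b := fun _ => M)).measure_lt_top.ne (measure_mono fun x hx => ?_)
    exact ⟨fun i => (abs_le.1 (hS x hx i)).1, fun i => (abs_le.1 (hS x hx i)).2⟩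
  set m : ℝ → ℝ := fun τ => volume.real (S ∩ {x | x j < τ}) with hm
  have hKnn : (0 : ℝ) ≤ 2 * (2 * M) ^ (d - 1) := by positivity
  have hlip : LipschitzWith ⟨2 * (2 * M) ^ (d - 1), hKnn⟩ m := by
    refine LipschitzWith.of_le_add_mul _ fun τ τ' => ?_
    have hslab := volume_slab_le (d := d) (w := Pi.single j 1) (j := j) (c := 1) (M := M)
      (δ := dist τ τ') τ one_pos (by simp) dist_nonneg hM
    have hsub : S ∩ {x | x j < τ} ⊆ (S ∩ {x | x j < τ'}) ∪
        {x : Fin d → ℝ | (∀ i, |x i| ≤ M) ∧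
          |∑ i, (Pi.single j 1 : Fin d → ℝ) i * x i - τ| ≤ dist τ τ'} := by
      rintro x ⟨hxS, hx⟩
      by_cases hx' : x j < τ'
      · exact Or.inl ⟨hxS, hx'⟩
      · refine Or.inr ⟨hS x hxS, ?_⟩
        have : ∑ i, (Pi.single j 1 : Fin d → ℝ) i * x i = x j := by
          simp [Pi.single_apply]
        rw [this, Real.dist_eq, abs_sub_comm, abs_of_pos (sub_pos.2 hx)]
        refine le_trans ?_ (le_abs_self _)
        linarith [not_lt.1 hx']
    have hfin : volume (S ∩ {x | x j < τ'}) ≠ ⊤ :=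
      ne_top_of_le_ne_top hSfin (measure_mono Set.inter_subset_left)
    refine (measureReal_mono hsub (measure_union_ne_top hfin
      (ne_top_of_le_ne_top ENNReal.ofReal_ne_top hslab))).trans
        ((measureReal_union_le _ _).trans (add_le_add_right ?_ _))
    refine ENNReal.toReal_le_of_le_ofReal (mul_nonneg hKnn dist_nonneg) ?_
    rwa [div_one] at hslab
  have hlow : m (-M) = 0 := by
    have : S ∩ {x | x j < -M} = ∅ := by
      ext x
      simp only [Set.mem_inter_iff, Set.mem_ofPred_eq, Set.mem_empty_iff_false, iff_false, not_and]
      intro hx h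
      linarith [(abs_le.1 (hS x hx j)).1]
    simp [hm, this]
  have hhigh : m (M + 1) = volume.real S := by
    have : S ∩ {x | x j < M + 1} = S :=
      Set.inter_eq_left.2 fun x hx => by
        have := (abs_le.1 (hS x hx j)).2
        simp only [Set.mem_ofPred_eq]
        linarith
    simp [hm, this]
  have := intermediate_value_Icc (by linarith : -M ≤ M + 1) hlip.continuous.continuousOn
  rw [hlow, hhigh] at this
  obtain ⟨τ, -, hτ⟩ := this hu
  exact ⟨τ, hτ⟩

/-- The `n`-th cell is a set `W n` inside `U n`, without the sets `W m` for `m > n`; the volume of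
`W n` exceeds the sum of the volumes of these. -/
theorem exists_disjoint_cells_nat {d : ℕ} (hd : 0 < d) {U : ℕ → Set (Fin d → ℝ)}
    (hU : ∀ n, IsOpen (U n)) (hne : ∀ n, (U n).Nonempty) {ε : ℝ} (hε : 0 < ε) :
    ∃ D : ℕ → Set (Fin d → ℝ), (∀ n, MeasurableSet (D n)) ∧ (∀ n, D n ⊆ U n) ∧
      Pairwise (Function.onFun Disjoint D) ∧ (∀ n, 0 < volume (D n)) ∧
      (∀ n, ∃ M : ℝ, 0 ≤ M ∧ ∀ x ∈ D n, ∀ i, |x i| ≤ M) ∧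
      ∑' n, volume (D n) ≤ ENNReal.ofReal ε := by
  wlog hε1 : ε ≤ 1 generalizing ε
  · obtain ⟨D, h1, h2, h3, h4, h5, h6⟩ := this one_pos le_rfl
    exact ⟨D, h1, h2, h3, h4, h5, h6.trans (ENNReal.ofReal_le_ofReal (not_le.1 hε1).le)⟩
  have hball : ∀ n, ∃ B : Set (Fin d → ℝ), B ⊆ U n ∧ MeasurableSet B ∧ 0 < volume.real B ∧
      ∃ M : ℝ, 0 ≤ M ∧ ∀ x ∈ B, ∀ i, |x i| ≤ M := fun n => by
    obtain ⟨x, hx⟩ := hne n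
    obtain ⟨ρ, hρ, hsub⟩ := Metric.isOpen_iff.1 (hU n) x hx
    refine ⟨Metric.ball x ρ, hsub, measurableSet_ball, ?_, ‖x‖ + ρ, by positivity, ?_⟩
    · exact ENNReal.toReal_pos (Metric.measure_ball_pos volume x hρ).ne' measure_ball_lt_top.ne
    · intro y hy i
      have h1 := norm_le_pi_norm y i
      have h2 := norm_le_norm_add_norm_sub' y x
      rw [Metric.mem_ball, dist_eq_norm] at hy
      rw [Real.norm_eq_abs] at h1
      linarith
  choose B hBU hBm hBpos M hM0 hBM using hball
  -- `w n` is to be the volume of `W n`; since `w (n + 1) ≤ w n / 3`, it exceeds `∑ m > n, w m`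
  set u : ℕ → ℝ := fun n => min 1 (volume.real (B n)) with hu
  have hupos : ∀ n, 0 < u n := fun n => lt_min one_pos (hBpos n)
  have hu1 : ∀ n, u n ≤ 1 := fun n => min_le_left _ _
  set w : ℕ → ℝ := fun n => ε * ∏ i ∈ Finset.range (n + 1), (u i / 3) with hw
  have hwpos : ∀ n, 0 < w n := fun n =>
    mul_pos hε (Finset.prod_pos fun i _ => div_pos (hupos i) (by norm_num))
  have hwsucc : ∀ n, w (n + 1) = w n * (u (n + 1) / 3) := fun n => by
    simp only [hw]; rw [Finset.prod_range_succ]; ring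
  have hwgeom : ∀ n i, w (n + i) ≤ w n * (1 / 3) ^ i := fun n i => by
    induction i with
    | zero => simp
    | succ i ih =>
      rw [← add_assoc, hwsucc, pow_succ, ← mul_assoc]
      exact mul_le_mul ih (by linarith [hu1 (n + i + 1)])
        (div_pos (hupos _) (by norm_num)).le (by have := hwpos n; positivity)
  have hw0 : w 0 ≤ ε / 3 := by
    simp only [hw, zero_add, Finset.prod_range_one]
    nlinarith [hu1 0]
  have hwB : ∀ n, w n ≤ volume.real (B n) := fun n => by
    have h1 : w n ≤ u n := by
      cases n with
      | zero =>
        simp only [hw, zero_add, Finset.prod_range_one]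
        nlinarith [hupos 0]
      | succ n =>
        have h2 : w n ≤ 1 := by
          have h3 := hwgeom 0 n
          rw [zero_add] at h3
          have h4 : ((1 : ℝ) / 3) ^ n ≤ 1 := pow_le_one₀ (by norm_num) (by norm_num)
          nlinarith [hwpos 0]
        rw [hwsucc]
        nlinarith [hupos (n + 1), hwpos n]
    exact h1.trans (min_le_right _ _)
  have hcut := fun n => exists_volume_inter_lt_eq ⟨0, hd⟩ (hM0 n) (hBM n)
    ⟨(hwpos n).le, hwB n⟩
  choose τ hτ using hcut
  set W : ℕ → Set (Fin d → ℝ) := fun n => B n ∩ {x | x ⟨0, hd⟩ < τ n} with hW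
  have hWm : ∀ n, MeasurableSet (W n) := fun n =>
    (hBm n).inter (measurableSet_lt (measurable_pi_apply _) measurable_const)
  have hWvol : ∀ n, volume (W n) = ENNReal.ofReal (w n) := fun n => by
    have h1 : volume (W n) ≠ ⊤ := by
      intro h
      have := hτ n
      rw [Measure.real, h] at this
      exact (hwpos n).ne this
    rw [← hτ n, Measure.real, ENNReal.ofReal_toReal h1]
  have htail : ∀ (a : ℝ), 0 ≤ a → ∑' i : ℕ, ENNReal.ofReal (a * (1 / 3) ^ (i + 1)) =
      ENNReal.ofReal (a / 2) := fun a ha => by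
    have hs : HasSum (fun i : ℕ => a * ((1 : ℝ) / 3) ^ (i + 1)) (a / 2) := by
      have h1 := (hasSum_geometric_of_lt_one (r := (1 : ℝ) / 3) (by norm_num)
        (by norm_num)).mul_left (a * (1 / 3))
      have h2 : a * (1 / 3) * (1 - 1 / 3 : ℝ)⁻¹ = a / 2 := by norm_num; ring
      rw [h2] at h1
      refine h1.congr_fun fun i => ?_
      rw [pow_succ]; ring
    rw [← ENNReal.ofReal_tsum_of_nonneg (fun i => by positivity) hs.summable, hs.tsum_eq]
  set D : ℕ → Set (Fin d → ℝ) := fun n => W n \ ⋃ i, W (n + (i + 1)) with hD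
  have hDW : ∀ n, D n ⊆ W n := fun n => Set.sdiff_subset
  refine ⟨D, fun n => (hWm n).diff (MeasurableSet.iUnion fun i => hWm _),
    fun n => (hDW n).trans (Set.inter_subset_left.trans (hBU n)), ?_, fun n => ?_,
    fun n => ⟨M n, hM0 n, fun x hx => hBM n x (hDW n hx).1⟩, ?_⟩
  · refine (symm_disjoint.pairwise_on D).2 fun m n hmn => ?_
    refine Set.disjoint_left.2 fun x hxm hxn => hxm.2 (Set.mem_iUnion.2 ⟨n - m - 1, ?_⟩)
    rw [show m + (n - m - 1 + 1) = n by omega]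
    exact hDW n hxn
  · have h1 : volume (⋃ i, W (n + (i + 1))) ≤ ENNReal.ofReal (w n / 2) := by
      refine (measure_iUnion_le _).trans ?_
      rw [← htail _ (hwpos n).le]
      refine ENNReal.tsum_le_tsum fun i => ?_
      rw [hWvol]
      exact ENNReal.ofReal_le_ofReal (hwgeom _ _)
    refine lt_of_lt_of_le ?_ (le_measure_sdiff)
    rw [tsub_pos_iff_lt, hWvol]
    exact h1.trans_lt ((ENNReal.ofReal_lt_ofReal_iff (hwpos n)).2 (by linarith [hwpos n]))
  · calc ∑' n, volume (D n) ≤ ∑' n : ℕ, ENNReal.ofReal (ε * (1 / 3) ^ (n + 1)) := by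
          refine ENNReal.tsum_le_tsum fun n => (measure_mono (hDW n)).trans ?_
          rw [hWvol]
          refine ENNReal.ofReal_le_ofReal ?_
          have h3 := hwgeom 0 n
          rw [zero_add] at h3
          refine h3.trans ?_
          rw [pow_succ]
          have : (0 : ℝ) < (1 / 3) ^ n := by positivity
          nlinarith
      _ ≤ ENNReal.ofReal ε := by
          rw [htail _ hε.le]
          exact ENNReal.ofReal_le_ofReal (by linarith)

/-- Given countably many nonempty open sets, there are pairwise disjoint bounded sets of positive
volume inside them, of small total volume. -/
theorem exists_disjoint_cells {d : ℕ} (hd : 0 < d) {ι : Type*} [Countable ι]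
    {U : ι → Set (Fin d → ℝ)} (hU : ∀ i, IsOpen (U i)) (hne : ∀ i, (U i).Nonempty) {ε : ℝ}
    (hε : 0 < ε) :
    ∃ D : ι → Set (Fin d → ℝ), (∀ i, MeasurableSet (D i)) ∧ (∀ i, D i ⊆ U i) ∧
      Pairwise (Function.onFun Disjoint D) ∧ (∀ i, 0 < volume (D i)) ∧
      (∀ i, ∃ M : ℝ, 0 ≤ M ∧ ∀ x ∈ D i, ∀ j, |x j| ≤ M) ∧
      ∑' i, volume (D i) ≤ ENNReal.ofReal ε := by
  obtain ⟨e, he⟩ := exists_injective_nat ι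
  have hext : ∀ n, IsOpen (Function.extend e U (fun _ => Set.univ) n) ∧
      (Function.extend e U (fun _ => Set.univ) n).Nonempty := fun n => by
    by_cases h : ∃ i, e i = n
    · obtain ⟨i, rfl⟩ := h
      rw [he.extend_apply]
      exact ⟨hU i, hne i⟩
    · rw [Function.extend_apply' _ _ _ h]
      exact ⟨isOpen_univ, Set.univ_nonempty⟩
  obtain ⟨D, h1, h2, h3, h4, h5, h6⟩ :=
    exists_disjoint_cells_nat hd (fun n => (hext n).1) (fun n => (hext n).2) hε
  refine ⟨fun i => D (e i), fun i => h1 _, fun i => ?_, fun i j hij => h3 (he.ne hij),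
    fun i => h4 _, fun i => h5 _, (ENNReal.tsum_comp_le_tsum_of_injective he _).trans h6⟩
  have := h2 (e i)
  rwa [he.extend_apply] at this

/-! ### Regions cut out of a cube -/

/-- Index type of the parameters of a cube with `t` hyperplanes in `ℝ^d`: the side length, the
coordinates of the lower corner, and the coordinates of the `t` normal vectors. -/
abbrev ParamIndex (d t : ℕ) : Type := (Unit ⊕ Fin d) ⊕ (Fin t × Fin d)

/-- The parameters of a cube with `t` hyperplanes. Together with a vector of signs
`β : Fin t → SignType`, they describe the hyperplanes `normal i ⬝ (x - corner) = β i * side`; by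
rescaling its normal vector every hyperplane can be written in this way, so that a hyperplane
takes up only `d` parameters. -/
abbrev Param (d t : ℕ) : Type := ParamIndex d t → ℝ

namespace Param

variable {d t q : ℕ}

/-- The side length of the cube. -/
def side (p : Param d t) : ℝ := p (.inl (.inl ()))

/-- The lower corner of the cube. -/
def corner (p : Param d t) : Fin d → ℝ := fun j => p (.inl (.inr j))

/-- The normal vector of the `i`-th hyperplane. -/
def normal (p : Param d t) (i : Fin t) : Fin d → ℝ := fun j => p (.inr (i, j))

/-- The affine form whose zeros are the points of the `i`-th hyperplane. -/
def cutForm (β : Fin t → SignType) (p : Param d t) (i : Fin t) (x : Fin d → ℝ) : ℝ :=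
  ∑ j, p.normal i j * (x j - p.corner j) - (β i : ℝ) * p.side

/-- The side of each of the hyperplanes on which `x` lies; the hyperplanes themselves are counted
to the negative sides. -/
noncomputable def signs (β : Fin t → SignType) (p : Param d t) (x : Fin d → ℝ) : Fin t → Bool :=
  fun i => decide (0 < cutForm β p i x)

/-- The part of the cube that a labeling of the sign patterns assigns to the label `l`. -/
def region (β : Fin t → SignType) (label : (Fin t → Bool) → Fin q) (p : Param d t) (l : Fin q) :
    Set (Fin d → ℝ) :=
  {x | x ∈ MeasurableColoring.cube p.corner p.side ∧ label (signs β p x) = l}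

/-- The parameters that describe a nontrivial cube and genuine hyperplanes. -/
def admissible (d t : ℕ) : Set (Param d t) :=
  {p | 0 < p.side ∧ ∀ i, ∃ j, p.normal i j ≠ 0}

theorem continuous_side : Continuous (side : Param d t → ℝ) := continuous_apply _

theorem continuous_corner (j : Fin d) : Continuous fun p : Param d t => p.corner j :=
  continuous_apply _

theorem continuous_normal (i : Fin t) (j : Fin d) : Continuous fun p : Param d t => p.normal i j :=
  continuous_apply _

theorem continuous_cutForm (β : Fin t → SignType) (i : Fin t) :
    Continuous fun z : Param d t × (Fin d → ℝ) => cutForm β z.1 i z.2 := by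
  unfold cutForm
  refine Continuous.sub (continuous_finsetSum _ fun j _ => ?_)
    (continuous_const.mul (continuous_side.comp continuous_fst))
  exact ((continuous_normal i j).comp continuous_fst).mul
    (((continuous_apply j).comp continuous_snd).sub ((continuous_corner j).comp continuous_fst))

theorem measurable_signs (β : Fin t → SignType) (p : Param d t) : Measurable (signs β p) := by
  refine measurable_pi_iff.2 fun i => ?_
  have h1 : MeasurableSet {x | 0 < cutForm β p i x} :=
    measurableSet_lt measurable_const
      ((continuous_cutForm β i).comp (Continuous.prodMk_right p)).measurable
  refine measurable_to_bool ?_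
  convert h1 using 1
  ext x
  simp [signs]

theorem measurableSet_region (β : Fin t → SignType) (label : (Fin t → Bool) → Fin q)
    (p : Param d t) (l : Fin q) : MeasurableSet (region β label p l) :=
  measurableSet_Icc.inter
    (measurable_signs β p (MeasurableSet.of_discrete (s := {σ | label σ = l})))

theorem volume_region_ne_top (β : Fin t → SignType) (label : (Fin t → Bool) → Fin q)
    (p : Param d t) (l : Fin q) : volume (region β label p l) ≠ ⊤ :=
  ne_top_of_le_ne_top isCompact_Icc.measure_lt_top.ne (measure_mono fun _ hx => hx.1)

theorem pairwise_disjoint_region (β : Fin t → SignType) (label : (Fin t → Bool) → Fin q)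
    (p : Param d t) : Pairwise (Function.onFun Disjoint (region β label p)) :=
  fun _ _ hl => Set.disjoint_left.2 fun _ hx hx' => hl (hx.2.symm.trans hx'.2)

theorem iUnion_region (β : Fin t → SignType) (label : (Fin t → Bool) → Fin q) (p : Param d t) :
    ⋃ l, region β label p l = MeasurableColoring.cube p.corner p.side := by
  ext x
  simp [region]

/-- The points of the box `[-M, M]^d` that are close to a face of the cube or to one of the
hyperplanes. -/
def nearWalls (β : Fin t → SignType) (p : Param d t) (M δ : ℝ) : Set (Fin d → ℝ) :=
  {x | (∀ i, |x i| ≤ M) ∧ ((∃ j, |x j - p.corner j| ≤ δ) ∨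
    (∃ j, |x j - (p.corner j + p.side)| ≤ δ) ∨ ∃ i, |cutForm β p i x| ≤ δ)}

theorem volume_nearWalls_le (β : Fin t → SignType) {p : Param d t} {c M δ : ℝ} (hc : 0 < c)
    (hc1 : c ≤ 1) (hpc : ∀ i, ∃ j, c ≤ |p.normal i j|) (hδ : 0 ≤ δ) (hM : 0 ≤ M) :
    volume (nearWalls β p M δ) ≤
      ENNReal.ofReal ((d + d + t) * (2 * (2 * M) ^ (d - 1) / c) * δ) := by
  choose J hJ using hpc
  set w : (Fin d ⊕ Fin d) ⊕ Fin t → Fin d → ℝ :=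
    Sum.elim (Sum.elim (fun j => Pi.single j 1) (fun j => Pi.single j 1)) p.normal with hw
  set b : (Fin d ⊕ Fin d) ⊕ Fin t → ℝ :=
    Sum.elim (Sum.elim p.corner (fun j => p.corner j + p.side))
      (fun i => ∑ j, p.normal i j * p.corner j + (β i : ℝ) * p.side) with hb
  have hsub : nearWalls β p M δ ⊆
      ⋃ m, {x : Fin d → ℝ | (∀ i, |x i| ≤ M) ∧ |∑ i, w m i * x i - b m| ≤ δ} := by
    rintro x ⟨hx, ⟨j, hj⟩ | ⟨j, hj⟩ | ⟨i, hi⟩⟩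
    · refine Set.mem_iUnion.2 ⟨.inl (.inl j), hx, ?_⟩
      simpa [hw, hb, Pi.single_apply] using hj
    · refine Set.mem_iUnion.2 ⟨.inl (.inr j), hx, ?_⟩
      simpa [hw, hb, Pi.single_apply] using hj
    · refine Set.mem_iUnion.2 ⟨.inr i, hx, ?_⟩
      have : ∑ j, p.normal i j * x j - (∑ j, p.normal i j * p.corner j + (β i : ℝ) * p.side) =
          cutForm β p i x := by
        simp only [cutForm, mul_sub, Finset.sum_sub_distrib]; ring
      simpa only [hw, hb, Sum.elim_inr, this] using hi
  have hm : ∀ m, volume {x : Fin d → ℝ | (∀ i, |x i| ≤ M) ∧ |∑ i, w m i * x i - b m| ≤ δ} ≤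
      ENNReal.ofReal (2 * (2 * M) ^ (d - 1) / c * δ) := by
    rintro ((j | j) | i)
    · exact volume_slab_le (j := j) _ hc (by simpa [hw] using hc1) hδ hM
    · exact volume_slab_le (j := j) _ hc (by simpa [hw] using hc1) hδ hM
    · exact volume_slab_le (j := J i) _ hc (by simpa [hw] using hJ i) hδ hM
  refine (measure_mono hsub).trans ((measure_iUnion_fintype_le _ _).trans
    ((Finset.sum_le_sum fun m _ => hm m).trans (le_of_eq ?_)))
  rw [Finset.sum_const, Finset.card_univ, nsmul_eq_mul, ← ENNReal.ofReal_natCast,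
    ← ENNReal.ofReal_mul (by positivity)]
  congr 1
  simp only [Fintype.card_sum, Fintype.card_fin]
  push_cast
  ring

theorem exists_normal_bound {p : Param d t} (hp : p ∈ admissible d t) :
    ∃ c : ℝ, 0 < c ∧ c ≤ 1 ∧ ∀ i, ∃ j, c ≤ |p.normal i j| := by
  choose J hJ using hp.2
  have h1 : ∀ᶠ c : ℝ in nhdsWithin 0 (Set.Ioi 0), ∀ i, c ≤ |p.normal i (J i)| :=
    Filter.eventually_all.2 fun i =>
      nhdsWithin_le_nhds (eventually_le_nhds (abs_pos.2 (hJ i)))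
  have h2 : ∀ᶠ c : ℝ in nhdsWithin 0 (Set.Ioi 0), c ≤ 1 :=
    nhdsWithin_le_nhds (eventually_le_nhds one_pos)
  obtain ⟨c, ⟨hc, hc1⟩, hc0⟩ := ((h1.and h2).and self_mem_nhdsWithin).exists
  exact ⟨c, hc0, hc1, fun i => ⟨J i, hc i⟩⟩

theorem abs_cutForm_sub_le (β : Fin t → SignType) {p p' : Param d t} {x : Fin d → ℝ} {R : ℝ}
    (hp : ‖p‖ ≤ R) (hp' : ‖p'‖ ≤ R) (hx : ∀ j, |x j| ≤ 2 * R) (i : Fin t) :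
    |cutForm β p i x - cutForm β p' i x| ≤ (4 * R * d + 1) * dist p p' := by
  have hR : 0 ≤ R := (norm_nonneg p).trans hp
  have hcoord : ∀ m, |p m - p' m| ≤ dist p p' := fun m => dist_le_pi_dist p p' m
  have hterm : ∀ j, |p.normal i j * (x j - p.corner j) - p'.normal i j * (x j - p'.corner j)| ≤
      4 * R * dist p p' := fun j => by
    have h1 : |p.normal i j - p'.normal i j| ≤ dist p p' := hcoord _
    have h2 : |p.corner j - p'.corner j| ≤ dist p p' := hcoord _
    have h3 : |p.corner j| ≤ R := (norm_le_pi_norm p _).trans hp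
    have h4 : |p'.normal i j| ≤ R := (norm_le_pi_norm p' _).trans hp'
    have h5 : |x j - p.corner j| ≤ 3 * R := by
      refine (abs_sub _ _).trans ?_
      linarith [hx j]
    have heq : p.normal i j * (x j - p.corner j) - p'.normal i j * (x j - p'.corner j) =
        (p.normal i j - p'.normal i j) * (x j - p.corner j) -
          p'.normal i j * (p.corner j - p'.corner j) := by ring
    rw [heq]
    refine (abs_sub _ _).trans ?_
    rw [abs_mul, abs_mul]
    have h6 := mul_le_mul h1 h5 (abs_nonneg _) dist_nonneg
    have h7 := mul_le_mul h4 h2 (abs_nonneg _) hR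
    linarith
  have hside : |(β i : ℝ) * p.side - (β i : ℝ) * p'.side| ≤ dist p p' := by
    rw [← mul_sub, abs_mul]
    have h1 : |p.side - p'.side| ≤ dist p p' := hcoord _
    have h2 : |(β i : ℝ)| ≤ 1 := by
      cases β i <;> simp
    nlinarith [abs_nonneg (p.side - p'.side)]
  have heq : cutForm β p i x - cutForm β p' i x =
      ∑ j, (p.normal i j * (x j - p.corner j) - p'.normal i j * (x j - p'.corner j)) -
        ((β i : ℝ) * p.side - (β i : ℝ) * p'.side) := by
    simp only [cutForm, Finset.sum_sub_distrib]; ring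
  rw [heq]
  refine (abs_sub _ _).trans ?_
  have hsum := (Finset.abs_sum_le_sum_abs
    (fun j => p.normal i j * (x j - p.corner j) - p'.normal i j * (x j - p'.corner j))
    Finset.univ).trans (Finset.sum_le_sum fun j _ => hterm j)
  rw [Finset.sum_const, Finset.card_univ, Fintype.card_fin, nsmul_eq_mul] at hsum
  linarith

theorem abs_le_of_mem_cube {p : Param d t} {R : ℝ} (hp : ‖p‖ ≤ R) {x : Fin d → ℝ}
    (hx : x ∈ MeasurableColoring.cube p.corner p.side) (j : Fin d) : |x j| ≤ 2 * R := by
  have h1 : |p.corner j| ≤ R := (norm_le_pi_norm p _).trans hp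
  have h2 : |p.side| ≤ R := (norm_le_pi_norm p _).trans hp
  have h3 : p.corner j ≤ x j := hx.1 j
  have h4 : x j ≤ p.corner j + p.side := hx.2 j
  rw [abs_le] at h1 h2 ⊢
  constructor <;> linarith

/-- A point that moves from one region to another when the parameters change by `δ` is within
`O(δ)` of a wall. -/
theorem region_sdiff_subset_nearWalls (β : Fin t → SignType) (label : (Fin t → Bool) → Fin q)
    {p p' : Param d t} {R : ℝ} (hp : ‖p‖ ≤ R) (hp' : ‖p'‖ ≤ R) (l : Fin q) :
    region β label p l \ region β label p' l ⊆
      nearWalls β p (2 * R) ((4 * R * d + 2) * dist p p') := by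
  rintro x ⟨⟨hxC, hxl⟩, hx'⟩
  have hR : 0 ≤ R := (norm_nonneg p).trans hp
  have hcoord : ∀ m, |p m - p' m| ≤ dist p p' := fun m => dist_le_pi_dist p p' m
  have hδ : 0 ≤ dist p p' := dist_nonneg
  have hA : 2 * dist p p' ≤ (4 * R * d + 2) * dist p p' := by
    have : 0 ≤ 4 * R * d := by positivity
    nlinarith
  have hlo : ∀ j, p.corner j ≤ x j := hxC.1
  have hhi : ∀ j, x j ≤ p.corner j + p.side := hxC.2
  have hxM : ∀ j, |x j| ≤ 2 * R := abs_le_of_mem_cube hp hxC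
  refine ⟨hxM, ?_⟩
  have h2 : |p.side - p'.side| ≤ dist p p' := hcoord _
  have h1 : ∀ j, |p.corner j - p'.corner j| ≤ dist p p' := fun j => hcoord _
  by_cases hC : x ∈ MeasurableColoring.cube p'.corner p'.side
  · have hne : signs β p x ≠ signs β p' x := fun h => hx' ⟨hC, h ▸ hxl⟩
    obtain ⟨i, hi⟩ := Function.ne_iff.1 hne
    refine Or.inr (Or.inr ⟨i, ?_⟩)
    have h3 := abs_cutForm_sub_le β hp hp' hxM i
    have h4 : |cutForm β p i x| ≤ |cutForm β p i x - cutForm β p' i x| := by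
      simp only [signs, ne_eq, decide_eq_decide] at hi
      by_cases h5 : 0 < cutForm β p i x
      · have h6 : ¬ 0 < cutForm β p' i x := fun h => hi ⟨fun _ => h, fun _ => h5⟩
        rw [abs_of_pos h5, abs_of_pos (by linarith)]
        linarith
      · have h6 : 0 < cutForm β p' i x := by
          by_contra h
          exact hi ⟨fun h' => absurd h' h5, fun h' => absurd h' h⟩
        rw [abs_of_nonpos (not_lt.1 h5), abs_of_nonpos (by linarith)]
        linarith
    refine h4.trans (h3.trans ?_)
    linarith
  · have hC' : ¬ ((∀ j, p'.corner j ≤ x j) ∧ ∀ j, x j ≤ p'.corner j + p'.side) := hC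
    rw [not_and_or, not_forall, not_forall] at hC'
    rcases hC' with ⟨j, hj⟩ | ⟨j, hj⟩
    · refine Or.inl ⟨j, ?_⟩
      have := abs_le.1 (h1 j)
      rw [abs_of_nonneg (sub_nonneg.2 (hlo j))]
      linarith
    · refine Or.inr (Or.inl ⟨j, ?_⟩)
      have := abs_le.1 (h1 j)
      have := abs_le.1 h2
      rw [abs_of_nonpos (sub_nonpos.2 (hhi j))]
      linarith

/-- Near parameters with nonzero normal vectors, the regions depend on the parameters in a Lipschitz
way. -/
theorem exists_lipschitz_region (β : Fin t → SignType) (label : (Fin t → Bool) → Fin q)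
    {p₀ : Param d t} (hp₀ : p₀ ∈ admissible d t) :
    ∃ ρ > 0, ∃ L : ℝ, 0 ≤ L ∧ ∀ p ∈ Metric.closedBall p₀ ρ, ∀ p' ∈ Metric.closedBall p₀ ρ, ∀ l,
      volume.real (region β label p l \ region β label p' l) ≤ L * dist p p' := by
  obtain ⟨c, hc, hc1, hpc⟩ := exists_normal_bound hp₀
  set R := ‖p₀‖ + 1 with hR
  have hR0 : 0 ≤ R := by positivity
  refine ⟨c / 2, by positivity, (d + d + t) * (2 * (2 * (2 * R)) ^ (d - 1) / (c / 2)) *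
    (4 * R * d + 2), by positivity, fun p hp p' hp' l => ?_⟩
  have hnorm : ∀ p ∈ Metric.closedBall p₀ (c / 2), ‖p‖ ≤ R := fun p hp => by
    rw [Metric.mem_closedBall, dist_eq_norm] at hp
    have := norm_le_norm_add_norm_sub' p p₀
    linarith
  have hpc' : ∀ i, ∃ j, c / 2 ≤ |p.normal i j| := fun i => by
    obtain ⟨j, hj⟩ := hpc i
    refine ⟨j, ?_⟩
    have h1 : |p.normal i j - p₀.normal i j| ≤ c / 2 := (dist_le_pi_dist p p₀ _).trans hp
    have h2 := abs_sub_abs_le_abs_sub (p₀.normal i j) (p.normal i j)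
    rw [abs_sub_comm] at h2
    linarith
  refine ENNReal.toReal_le_of_le_ofReal (by positivity) ?_
  refine (measure_mono (region_sdiff_subset_nearWalls β label (hnorm p hp) (hnorm p' hp') l)).trans
    ((volume_nearWalls_le β (by positivity) (by linarith) hpc' (by positivity)
      (by positivity)).trans (le_of_eq ?_))
  congr 1
  ring

theorem volume_region_inter_le (β : Fin t → SignType) (label : (Fin t → Bool) → Fin q)
    (p p' : Param d t) (l : Fin q) (E : Set (Fin d → ℝ)) :
    volume.real (region β label p l ∩ E) ≤ volume.real (region β label p' l ∩ E) +
      volume.real (region β label p l \ region β label p' l) := by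
  have h1 : volume (region β label p' l ∩ E) ≠ ⊤ :=
    ne_top_of_le_ne_top (volume_region_ne_top β label p' l) (measure_mono Set.inter_subset_left)
  have h2 : volume (region β label p l \ region β label p' l) ≠ ⊤ :=
    ne_top_of_le_ne_top (volume_region_ne_top β label p l) (measure_mono Set.sdiff_subset)
  refine (measureReal_mono ?_ (measure_union_ne_top h1 h2)).trans (measureReal_union_le _ _)
  rintro x ⟨hx, hxE⟩
  by_cases h : x ∈ region β label p' l
  · exact Or.inl ⟨h, hxE⟩
  · exact Or.inr ⟨hx, h⟩

theorem volume_nearWalls_zero (β : Fin t → SignType) {p : Param d t} (hp : p ∈ admissible d t)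
    (M : ℝ) (hM : 0 ≤ M) : volume (nearWalls β p M 0) = 0 := by
  obtain ⟨c, hc, hc1, hpc⟩ := exists_normal_bound hp
  simpa using volume_nearWalls_le β hc hc1 hpc le_rfl hM

/-- A region of positive volume contains an open set that stays in the region when the parameters
change a little. -/
theorem exists_open_subset_region (β : Fin t → SignType) (label : (Fin t → Bool) → Fin q)
    {p₀ : Param d t} (hp₀ : p₀ ∈ admissible d t) {l : Fin q}
    (hl : volume (region β label p₀ l) ≠ 0) :
    ∃ O : Set (Fin d → ℝ), IsOpen O ∧ O.Nonempty ∧ ∀ᶠ p in nhds p₀, O ⊆ region β label p l := by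
  have hnull := volume_nearWalls_zero β hp₀ (2 * ‖p₀‖) (by positivity)
  have hne : (region β label p₀ l \ nearWalls β p₀ (2 * ‖p₀‖) 0).Nonempty := by
    refine nonempty_of_measure_ne_zero (μ := volume) ?_
    rwa [measure_sdiff_null hnull]
  obtain ⟨x, ⟨hxC, hxl⟩, hx⟩ := hne
  have hlo : ∀ j, p₀.corner j ≤ x j := hxC.1
  have hhi : ∀ j, x j ≤ p₀.corner j + p₀.side := hxC.2
  have hxM : ∀ j, |x j| ≤ 2 * ‖p₀‖ := abs_le_of_mem_cube le_rfl hxC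
  have hstrict : (∀ j, p₀.corner j < x j) ∧ (∀ j, x j < p₀.corner j + p₀.side) ∧
      ∀ i, cutForm β p₀ i x ≠ 0 := by
    refine ⟨fun j => lt_of_le_of_ne (hlo j) fun h => hx ⟨hxM, Or.inl ⟨j, ?_⟩⟩,
      fun j => lt_of_le_of_ne (hhi j) fun h => hx ⟨hxM, Or.inr (Or.inl ⟨j, ?_⟩)⟩,
      fun i h => hx ⟨hxM, Or.inr (Or.inr ⟨i, ?_⟩)⟩⟩
    · simp [h]
    · simp [h]
    · simp [h]
  have hev : ∀ᶠ z in nhds (p₀, x), z.2 ∈ region β label z.1 l := by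
    have h1 : ∀ᶠ z : Param d t × (Fin d → ℝ) in nhds (p₀, x), ∀ j, z.1.corner j < z.2 j :=
      Filter.eventually_all.2 fun j =>
        ((continuous_corner j).comp continuous_fst).continuousAt.eventually_lt
          ((continuous_apply j).comp continuous_snd).continuousAt (hstrict.1 j)
    have h2 : ∀ᶠ z : Param d t × (Fin d → ℝ) in nhds (p₀, x), ∀ j,
        z.2 j < z.1.corner j + z.1.side :=
      Filter.eventually_all.2 fun j =>
        ((continuous_apply j).comp continuous_snd).continuousAt.eventually_lt
          (((continuous_corner j).comp continuous_fst).add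
            (continuous_side.comp continuous_fst)).continuousAt (hstrict.2.1 j)
    have h3 : ∀ᶠ z : Param d t × (Fin d → ℝ) in nhds (p₀, x), ∀ i,
        signs β z.1 z.2 i = signs β p₀ x i := by
      refine Filter.eventually_all.2 fun i => ?_
      rcases lt_or_gt_of_ne (hstrict.2.2 i) with h | h
      · filter_upwards [(continuous_cutForm β i).continuousAt.eventually_lt
          (continuousAt_const (y := (0 : ℝ))) h] with z hz
        simp [signs, not_lt.2 hz.le, not_lt.2 h.le]
      · filter_upwards [(continuousAt_const (y := (0 : ℝ))).eventually_lt
          (continuous_cutForm β i).continuousAt h] with z hz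
        simp [signs, hz, h]
    filter_upwards [h1, h2, h3] with z hz1 hz2 hz3
    refine ⟨⟨fun j => (hz1 j).le, fun j => (hz2 j).le⟩, ?_⟩
    rw [← hxl]
    congr 1
    exact funext hz3
  obtain ⟨u, v, hu, hpu, hv, hxv, huv⟩ := mem_nhds_prod_iff'.1 hev
  exact ⟨v, hv, ⟨x, hxv⟩, Filter.mem_of_superset (hu.mem_nhds hpu) fun p hp y hy =>
    huv (Set.mk_mem_prod hp hy)⟩

end Param

/-! ### Parameters for which a label receives a prescribed share of the cube -/

namespace Param

variable {d t q : ℕ}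

/-- The points of `ℝ^d` with label `l` with respect to the hyperplanes `V i ⬝ y = β i`. -/
def unitRegion (β : Fin t → SignType) (label : (Fin t → Bool) → Fin q)
    (V : Fin t × Fin d → ℝ) (l : Fin q) : Set (Fin d → ℝ) :=
  {y | label (fun i => decide ((β i : ℝ) < ∑ j, V (i, j) * y j)) = l}

theorem measurableSet_unitRegion_prod (β : Fin t → SignType) (label : (Fin t → Bool) → Fin q)
    (l : Fin q) :
    MeasurableSet {z : (Fin t × Fin d → ℝ) × (Fin d → ℝ) | z.2 ∈ unitRegion β label z.1 l} := by
  have h1 : Measurable fun z : (Fin t × Fin d → ℝ) × (Fin d → ℝ) =>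
      fun i => decide ((β i : ℝ) < ∑ j, z.1 (i, j) * z.2 j) := by
    refine measurable_pi_iff.2 fun i => measurable_to_bool ?_
    have h2 : MeasurableSet {z : (Fin t × Fin d → ℝ) × (Fin d → ℝ) |
        (β i : ℝ) < ∑ j, z.1 (i, j) * z.2 j} := by
      refine measurableSet_lt measurable_const (Continuous.measurable ?_)
      fun_prop
    convert h2 using 1
    ext z
    simp
  exact h1 (MeasurableSet.of_discrete (s := {σ | label σ = l}))

theorem measurableSet_unitRegion (β : Fin t → SignType) (label : (Fin t → Bool) → Fin q)
    (V : Fin t × Fin d → ℝ) (l : Fin q) : MeasurableSet (unitRegion β label V l) :=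
  measurable_prodMk_left (measurableSet_unitRegion_prod β label l)

/-- The map `V ↦ (c j * V (i, j))` on tuples of normal vectors. -/
def scaleNormals (t : ℕ) (c : Fin d → ℝ) : (Fin t × Fin d → ℝ) →ₗ[ℝ] (Fin t × Fin d → ℝ) :=
  Matrix.toLin' (Matrix.diagonal fun m => c m.2)

theorem scaleNormals_apply (c : Fin d → ℝ) (V : Fin t × Fin d → ℝ) (m : Fin t × Fin d) :
    scaleNormals t c V m = c m.2 * V m := by
  simp [scaleNormals, Matrix.mulVec_diagonal]

/-- Scaling the normal vectors by `c` has the effect of replacing the unit cube by the box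
`[0, c]`. -/
theorem volume_unitRegion_scaleNormals (β : Fin t → SignType) (label : (Fin t → Bool) → Fin q)
    (V : Fin t × Fin d → ℝ) (l : Fin q) {c : Fin d → ℝ} (hc : ∀ j, 0 < c j) :
    (∏ j, c j) * volume.real (Set.Icc 0 1 ∩ unitRegion β label (scaleNormals t c V) l) =
      volume.real (Set.Icc 0 c ∩ unitRegion β label V l) := by
  set T : (Fin d → ℝ) →ₗ[ℝ] (Fin d → ℝ) := Matrix.toLin' (Matrix.diagonal c) with hT
  have hTx : ∀ x j, T x j = c j * x j := fun x j => by
    simp [hT, Matrix.mulVec_diagonal]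
  have hprod : 0 < ∏ j, c j := Finset.prod_pos fun j _ => hc j
  have hdet : LinearMap.det T = ∏ j, c j := by
    rw [hT, LinearMap.det_toLin', Matrix.det_diagonal]
  have hpre : Set.Icc 0 1 ∩ unitRegion β label (scaleNormals t c V) l =
      T ⁻¹' (Set.Icc 0 c ∩ unitRegion β label V l) := by
    ext x
    have h1 : x ∈ Set.Icc (0 : Fin d → ℝ) 1 ↔ T x ∈ Set.Icc 0 c := by
      simp only [Set.mem_Icc, Pi.le_def, hTx, Pi.zero_apply, Pi.one_apply]
      refine and_congr (forall_congr' fun j => ?_) (forall_congr' fun j => ?_)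
      · exact (mul_nonneg_iff_of_pos_left (hc j)).symm
      · exact (mul_le_iff_le_one_right (hc j)).symm
    have h2 : x ∈ unitRegion β label (scaleNormals t c V) l ↔ T x ∈ unitRegion β label V l := by
      have h3 : ∀ i, ∑ j, scaleNormals t c V (i, j) * x j = ∑ j, V (i, j) * T x j := fun i =>
        Finset.sum_congr rfl fun j _ => by rw [scaleNormals_apply, hTx]; ring
      simp only [unitRegion, Set.mem_ofPred_eq, h3]
    rw [Set.mem_inter_iff, Set.mem_preimage, Set.mem_inter_iff, h1, h2]
  rw [hpre, Measure.real, Measure.addHaar_preimage_linearMap _ (by rw [hdet]; exact hprod.ne'),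
    hdet, ENNReal.toReal_mul, ENNReal.toReal_ofReal (abs_nonneg _), abs_inv, abs_of_pos hprod,
    ← mul_assoc, mul_inv_cancel₀ hprod.ne', one_mul, Measure.real]

/-- For fixed hyperplanes, almost no box `[0, c]` has the share `θ` of its volume labeled `l`,
because the density of the label `l` is `0` or `1`, and not `θ`, at the corner `c`. As the boxes
`[0, c]` are scaled copies of the unit cube, the same holds for the unit cube and almost all
hyperplanes. -/
theorem volume_setOf_unitRegion_share_eq_zero (β : Fin t → SignType)
    (label : (Fin t → Bool) → Fin q) (l : Fin q) {θ : ℝ} (hθ : 0 < θ) (hθ1 : θ < 1) :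
    volume {V : Fin t × Fin d → ℝ |
      volume.real (Set.Icc (0 : Fin d → ℝ) 1 ∩ unitRegion β label V l) = θ} = 0 := by
  set Z : Set (Fin t × Fin d → ℝ) :=
    {V | volume.real (Set.Icc (0 : Fin d → ℝ) 1 ∩ unitRegion β label V l) = θ} with hZ
  have hZm : MeasurableSet Z := by
    have h1 : MeasurableSet {z : (Fin t × Fin d → ℝ) × (Fin d → ℝ) |
        z.2 ∈ Set.Icc 0 1 ∩ unitRegion β label z.1 l} :=
      (measurable_snd measurableSet_Icc).inter (measurableSet_unitRegion_prod β label l)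
    exact measurableSet_eq_fun
      ((measurable_measure_prodMk_left (ν := (volume : Measure (Fin d → ℝ))) h1).ennreal_toReal)
      measurable_const
  have hslice : ∀ V : Fin t × Fin d → ℝ, ∀ᵐ c : Fin d → ℝ,
      (∀ j, 0 < c j) → scaleNormals t c V ∉ Z := fun V => by
    have hAm := measurableSet_unitRegion β label V l
    set A := unitRegion β label V l with hA
    have hgm : Measurable fun y => A.indicator (fun _ => (1 : ℝ)) y - θ :=
      (measurable_const.indicator hAm).sub measurable_const
    have hgb : ∀ y, |A.indicator (fun _ => (1 : ℝ)) y - θ| ≤ 1 := fun y => by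
      by_cases hy : y ∈ A
      · rw [Set.indicator_of_mem hy, abs_le]; constructor <;> linarith
      · rw [Set.indicator_of_notMem hy, abs_le]; constructor <;> linarith
    filter_upwards [ae_eq_zero_of_setIntegral_Icc_eq_zero hgm hgb] with c h0 hc hcZ
    have hne : A.indicator (fun _ => (1 : ℝ)) c - θ ≠ 0 := by
      by_cases hy : c ∈ A
      · rw [Set.indicator_of_mem hy]; linarith
      · rw [Set.indicator_of_notMem hy]; linarith
    refine hne (h0 hc ?_)
    have hfin : volume (Set.Icc (0 : Fin d → ℝ) c) ≠ ⊤ := isCompact_Icc.measure_lt_top.ne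
    have hi1 : IntegrableOn (A.indicator fun _ => (1 : ℝ)) (Set.Icc 0 c) volume :=
      IntegrableOn.indicator (integrableOn_const hfin) hAm
    have hi2 : IntegrableOn (fun _ : Fin d → ℝ => θ) (Set.Icc 0 c) volume :=
      integrableOn_const hfin
    have hbox : volume.real (Set.Icc (0 : Fin d → ℝ) c) = ∏ j, c j := by
      have h1 := Real.volume_Icc_pi_toReal (a := 0) (b := c) fun j => (hc j).le
      simpa [Measure.real] using h1
    have hcZ' : volume.real (Set.Icc (0 : Fin d → ℝ) 1 ∩
      unitRegion β label (scaleNormals t c V) l) = θ := hcZ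
    rw [integral_sub hi1 hi2, setIntegral_indicator hAm, setIntegral_const, setIntegral_const,
      smul_eq_mul, smul_eq_mul, mul_one, hbox, ← volume_unitRegion_scaleNormals β label V l hc,
      hcZ', sub_self]
  have hprod : ∀ᵐ z : (Fin d → ℝ) × (Fin t × Fin d → ℝ) ∂(volume.prod volume),
      (∀ j, 0 < z.1 j) → scaleNormals t z.1 z.2 ∉ Z := by
    refine ae_prod_of_ae_left ?_ hslice
    have hpos : MeasurableSet {z : (Fin d → ℝ) × (Fin t × Fin d → ℝ) | ∀ j, 0 < z.1 j} := by
      rw [Set.ofPred_forall]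
      exact MeasurableSet.iInter fun j =>
        measurableSet_lt measurable_const ((measurable_pi_apply j).comp measurable_fst)
    have hsc : Measurable fun z : (Fin d → ℝ) × (Fin t × Fin d → ℝ) =>
        scaleNormals t z.1 z.2 := by
      refine measurable_pi_iff.2 fun m => ?_
      simp only [scaleNormals_apply]
      exact ((measurable_pi_apply _).comp measurable_fst).mul
        ((measurable_pi_apply _).comp measurable_snd)
    exact hpos.himp (hsc hZm).compl
  obtain ⟨c, hc, hcZ⟩ := (Measure.dense_of_ae (Measure.ae_ae_of_ae_prod hprod)).inter_open_nonempty
    {c : Fin d → ℝ | ∀ j, 0 < c j}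
    (by
      rw [Set.ofPred_forall]
      exact isOpen_iInter_of_finite fun j => isOpen_lt continuous_const (continuous_apply j))
    ⟨1, fun j => one_pos⟩
  have hnull : volume (scaleNormals t c ⁻¹' Z) = 0 := by
    have h1 : ∀ᵐ V : Fin t × Fin d → ℝ, scaleNormals t c V ∉ Z := by
      filter_upwards [hcZ] with V hV using hV hc
    exact measure_eq_zero_iff_ae_notMem.2 h1
  have hdet : LinearMap.det (scaleNormals t c) ≠ 0 := by
    rw [scaleNormals, LinearMap.det_toLin', Matrix.det_diagonal]
    exact Finset.prod_ne_zero_iff.2 fun m _ => (hc m.2).ne'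
  rw [Measure.addHaar_preimage_linearMap _ hdet, mul_eq_zero] at hnull
  refine hnull.resolve_left ?_
  simpa using hdet

theorem volume_region_eq (β : Fin t → SignType) (label : (Fin t → Bool) → Fin q) (l : Fin q)
    {p : Param d t} (hp : 0 < p.side) :
    volume.real (region β label p l) = p.side ^ d *
      volume.real (Set.Icc 0 1 ∩ unitRegion β label (fun m => p (.inr m)) l) := by
  set B := Set.Icc 0 1 ∩ unitRegion β label (fun m => p (.inr m)) l with hB
  have hpre : region β label p l =
      (fun x => x + -p.corner) ⁻¹' ((fun x => p.side⁻¹ • x) ⁻¹' B) := by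
    ext x
    have h1 : x ∈ MeasurableColoring.cube p.corner p.side ↔
        p.side⁻¹ • (x + -p.corner) ∈ Set.Icc (0 : Fin d → ℝ) 1 := by
      simp only [MeasurableColoring.cube, Set.mem_Icc, Pi.le_def, Pi.zero_apply, Pi.one_apply,
        Pi.smul_apply, Pi.add_apply, Pi.neg_apply, smul_eq_mul]
      refine and_congr (forall_congr' fun j => ?_) (forall_congr' fun j => ?_)
      · rw [mul_nonneg_iff_of_pos_left (inv_pos.2 hp)]
        constructor <;> intro h <;> linarith
      · rw [inv_mul_le_iff₀ hp]
        constructor <;> intro h <;> linarith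
    have h2 : signs β p x = fun i => decide ((β i : ℝ) <
        ∑ j, p (.inr (i, j)) * (p.side⁻¹ • (x + -p.corner)) j) := by
      funext i
      rw [signs, decide_eq_decide, cutForm, sub_pos]
      have h3 : ∑ j, p (.inr (i, j)) * (p.side⁻¹ • (x + -p.corner)) j =
          (∑ j, p.normal i j * (x j - p.corner j)) / p.side := by
        rw [Finset.sum_div]
        refine Finset.sum_congr rfl fun j _ => ?_
        simp only [normal, Pi.smul_apply, Pi.add_apply, Pi.neg_apply, smul_eq_mul]
        ring
      rw [h3, lt_div_iff₀ hp]
    simp only [region, hB, Set.mem_preimage, Set.mem_inter_iff, unitRegion, Set.mem_ofPred_eq,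
      h1, h2]
  rw [hpre, Measure.real, measure_preimage_add_right,
    Measure.addHaar_preimage_smul _ (inv_ne_zero hp.ne'), ENNReal.toReal_mul,
    ENNReal.toReal_ofReal (abs_nonneg _), Measure.real]
  congr 1
  rw [Module.finrank_fin_fun, inv_pow, inv_inv, abs_of_pos (by positivity)]

/-- The parameters for which the label `l` receives the share `θ` of the cube form a null set. -/
theorem volume_setOf_region_share_eq_zero (β : Fin t → SignType)
    (label : (Fin t → Bool) → Fin q) (l : Fin q) {θ : ℝ} (hθ : 0 < θ) (hθ1 : θ < 1) :
    volume {p : Param d t | 0 < p.side ∧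
      volume.real (region β label p l) = θ * p.side ^ d} = 0 := by
  have h1 : ∀ᵐ V : Fin t × Fin d → ℝ,
      volume.real (Set.Icc (0 : Fin d → ℝ) 1 ∩ unitRegion β label V l) ≠ θ :=
    measure_eq_zero_iff_ae_notMem.1 (volume_setOf_unitRegion_share_eq_zero β label l hθ hθ1)
  have h2 := (volume_measurePreserving_sumPiEquivProdPi
    (fun _ : ParamIndex d t => ℝ)).quasiMeasurePreserving.ae
      (Measure.quasiMeasurePreserving_snd.ae h1)
  refine measure_eq_zero_iff_ae_notMem.2 ?_
  filter_upwards [h2] with p hp hpθ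
  refine hp ?_
  have h3 := volume_region_eq β label l hpθ.1
  rw [hpθ.2, mul_comm] at h3
  exact (mul_left_cancel₀ (pow_pos hpθ.1 d).ne' h3).symm

end Param

/-! ### Recoloring on disjoint cells -/

/-- A family of disjoint cells of finite total volume, indexed by `ℕ × Fin K`, in each of which a
part is selected that depends on a real parameter `x` and fills the proportion `sigmoid x`. The
second index of a cell is the color that its selected part is to receive. -/
structure CellSystem (d K : ℕ) where
  /-- the cells -/
  cell : ℕ × Fin K → Set (Fin d → ℝ)
  /-- the selected part of a cell -/
  part : ℕ × Fin K → ℝ → Set (Fin d → ℝ)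
  measurableSet_cell : ∀ c, MeasurableSet (cell c)
  disjoint_cell : Pairwise (Function.onFun Disjoint cell)
  volume_cell_ne_zero : ∀ c, volume (cell c) ≠ 0
  tsum_volume_cell_ne_top : ∑' c, volume (cell c) ≠ ⊤
  measurableSet_part : ∀ c x, MeasurableSet (part c x)
  part_subset : ∀ c x, part c x ⊆ cell c
  part_nested : ∀ c x y, part c x ⊆ part c y ∨ part c y ⊆ part c x
  volume_part : ∀ c x, volume.real (part c x) = Real.sigmoid x * volume.real (cell c)

namespace CellSystem

variable {d K : ℕ}

theorem exists_subset_of_isOpen (hd : 0 < d) {U : ℕ → Set (Fin d → ℝ)} (hU : ∀ n, IsOpen (U n))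
    (hne : ∀ n, (U n).Nonempty) {ε : ℝ} (hε : 0 < ε) :
    ∃ 𝒟 : CellSystem d K, (∀ c, 𝒟.cell c ⊆ U c.1) ∧
      ∑' c, volume (𝒟.cell c) ≤ ENNReal.ofReal ε := by
  obtain ⟨D, hDm, hDU, hDd, hDpos, hDb, hDε⟩ := exists_disjoint_cells hd (ι := ℕ × Fin K)
    (U := fun c => U c.1) (fun c => hU _) (fun c => hne _) hε
  have hcut : ∀ c x, ∃ τ : ℝ, volume.real (D c ∩ {y | y ⟨0, hd⟩ < τ}) =
      Real.sigmoid x * volume.real (D c) := fun c x => by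
    obtain ⟨M, hM, hDM⟩ := hDb c
    exact exists_volume_inter_lt_eq ⟨0, hd⟩ hM hDM
      ⟨mul_nonneg (Real.sigmoid_nonneg x) measureReal_nonneg,
        mul_le_of_le_one_left measureReal_nonneg (Real.sigmoid_le_one x)⟩
  choose τ hτ using hcut
  refine ⟨⟨D, fun c x => D c ∩ {y | y ⟨0, hd⟩ < τ c x}, hDm, hDd, fun c => (hDpos c).ne',
    ne_top_of_le_ne_top ENNReal.ofReal_ne_top hDε, fun c x => ?_, fun c x => Set.inter_subset_left,
    fun c x y => ?_, hτ⟩, hDU, hDε⟩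
  · exact (hDm c).inter (measurableSet_lt (measurable_pi_apply _) measurable_const)
  · rcases le_total (τ c x) (τ c y) with h | h
    · exact Or.inl fun z hz => ⟨hz.1, lt_of_lt_of_le hz.2 h⟩
    · exact Or.inr fun z hz => ⟨hz.1, lt_of_lt_of_le hz.2 h⟩

variable (𝒟 : CellSystem d K)

theorem volume_cell_ne_top (c : ℕ × Fin K) : volume (𝒟.cell c) ≠ ⊤ :=
  ENNReal.ne_top_of_tsum_ne_top 𝒟.tsum_volume_cell_ne_top c

theorem volume_real_cell_pos (c : ℕ × Fin K) : 0 < volume.real (𝒟.cell c) :=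
  ENNReal.toReal_pos (𝒟.volume_cell_ne_zero c) (𝒟.volume_cell_ne_top c)

theorem summable_volume_cell : Summable fun c => volume.real (𝒟.cell c) :=
  ENNReal.summable_toReal 𝒟.tsum_volume_cell_ne_top

theorem volume_symmDiff_part (c : ℕ × Fin K) (x y : ℝ) :
    volume (symmDiff (𝒟.part c x) (𝒟.part c y)) =
      ENNReal.ofReal (|Real.sigmoid x - Real.sigmoid y| * volume.real (𝒟.cell c)) := by
  have hfin : ∀ x, volume (𝒟.part c x) ≠ ⊤ := fun x =>
    ne_top_of_le_ne_top (𝒟.volume_cell_ne_top c) (measure_mono (𝒟.part_subset c x))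
  wlog h : 𝒟.part c x ⊆ 𝒟.part c y generalizing x y
  · rw [symmDiff_comm, abs_sub_comm]
    exact this y x ((𝒟.part_nested c x y).resolve_left h)
  have hvol : volume (symmDiff (𝒟.part c x) (𝒟.part c y)) =
      volume (𝒟.part c y \ 𝒟.part c x) := by
    rw [Set.symmDiff_def, Set.sdiff_eq_empty.2 h, Set.empty_union]
  have hreal := measureReal_sdiff (μ := volume) h (𝒟.measurableSet_part c x) (hfin y)
  rw [𝒟.volume_part, 𝒟.volume_part, ← sub_mul] at hreal
  have hle : Real.sigmoid x ≤ Real.sigmoid y := by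
    by_contra hlt
    have := mul_neg_of_neg_of_pos (sub_neg.2 (not_le.1 hlt)) (𝒟.volume_real_cell_pos c)
    linarith [measureReal_nonneg (μ := volume) (s := 𝒟.part c y \ 𝒟.part c x)]
  rw [hvol, abs_sub_comm, abs_of_nonneg (sub_nonneg.2 hle), ← hreal, Measure.real,
    ENNReal.ofReal_toReal (ne_top_of_le_ne_top (hfin y) (measure_mono Set.sdiff_subset))]

open Classical in
/-- The color that `x` receives when, in each cell `c`, the selected part gets the color `c.2` and
the rest of the cell the last color, while `g` is unchanged outside the cells. -/
noncomputable def recolorFun (g : (Fin d → ℝ) → Fin (K + 1)) (a : ℕ × Fin K → ℝ)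
    (x : Fin d → ℝ) : Fin (K + 1) :=
  if h : ∃ c, x ∈ 𝒟.cell c then
    if x ∈ 𝒟.part h.choose (a h.choose) then h.choose.2.castSucc else Fin.last K
  else g x

theorem eq_of_mem_cell {x : Fin d → ℝ} {c c' : ℕ × Fin K} (h : x ∈ 𝒟.cell c)
    (h' : x ∈ 𝒟.cell c') : c = c' := by
  by_contra hne
  exact Set.disjoint_left.1 (𝒟.disjoint_cell hne) h h'

open Classical in
theorem recolorFun_of_mem (g : (Fin d → ℝ) → Fin (K + 1)) (a : ℕ × Fin K → ℝ)
    {x : Fin d → ℝ} {c : ℕ × Fin K} (hx : x ∈ 𝒟.cell c) :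
    𝒟.recolorFun g a x = if x ∈ 𝒟.part c (a c) then c.2.castSucc else Fin.last K := by
  have h : ∃ c, x ∈ 𝒟.cell c := ⟨c, hx⟩
  have hc : h.choose = c := 𝒟.eq_of_mem_cell h.choose_spec hx
  rw [recolorFun, dif_pos h, hc]

theorem recolorFun_of_notMem (g : (Fin d → ℝ) → Fin (K + 1)) (a : ℕ × Fin K → ℝ)
    {x : Fin d → ℝ} (hx : ∀ c, x ∉ 𝒟.cell c) : 𝒟.recolorFun g a x = g x := by
  rw [recolorFun, dif_neg (not_exists.2 hx)]

/-- The recoloring of `g` with parameters `a`. -/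
noncomputable def recolor (g : MeasurableColoring d (K + 1)) (a : ℕ × Fin K → ℝ) :
    MeasurableColoring d (K + 1) where
  color := 𝒟.recolorFun g.color a
  lebesgueMeasurable j := by
    classical
    have hset : 𝒟.recolorFun g.color a ⁻¹' {j} = (g.color ⁻¹' {j} \ ⋃ c, 𝒟.cell c) ∪
        ⋃ c, 𝒟.cell c ∩
          {x | (if x ∈ 𝒟.part c (a c) then c.2.castSucc else Fin.last K) = j} := by
      ext x
      by_cases hx : ∃ c, x ∈ 𝒟.cell c
      · obtain ⟨c, hc⟩ := hx
        rw [Set.mem_preimage, 𝒟.recolorFun_of_mem _ _ hc]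
        constructor
        · exact fun h => Or.inr (Set.mem_iUnion.2 ⟨c, hc, h⟩)
        · rintro (h | h)
          · exact absurd (Set.mem_iUnion.2 ⟨c, hc⟩) h.2
          · obtain ⟨c', hc', h'⟩ := Set.mem_iUnion.1 h
            rwa [← 𝒟.eq_of_mem_cell hc hc'] at h'
      · rw [not_exists] at hx
        rw [Set.mem_preimage, 𝒟.recolorFun_of_notMem _ _ hx]
        constructor
        · exact fun h => Or.inl ⟨h, fun h' => (Set.mem_iUnion.1 h').elim hx⟩
        · rintro (h | h)
          · exact h.1
          · obtain ⟨c', hc', -⟩ := Set.mem_iUnion.1 h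
            exact absurd hc' (hx c')
    rw [hset]
    refine ((g.lebesgueMeasurable j).diff
      (MeasurableSet.iUnion 𝒟.measurableSet_cell).nullMeasurableSet).union
        (MeasurableSet.iUnion fun c => (𝒟.measurableSet_cell c).inter ?_).nullMeasurableSet
    exact (Measurable.ite (𝒟.measurableSet_part c (a c)) measurable_const measurable_const)
      (measurableSet_singleton j)

/-- A bound for the volume of the set where the recolorings with parameters `a` and `b` differ. -/
noncomputable def recolorDiff (a b : ℕ × Fin K → ℝ) : ℝ :=
  ∑' c, |Real.sigmoid (a c) - Real.sigmoid (b c)| * volume.real (𝒟.cell c)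

theorem abs_sigmoid_sub_mul_le (c : ℕ × Fin K) (x y : ℝ) :
    ‖|Real.sigmoid x - Real.sigmoid y| * volume.real (𝒟.cell c)‖ ≤ volume.real (𝒟.cell c) := by
  rw [Real.norm_of_nonneg (mul_nonneg (abs_nonneg _) measureReal_nonneg)]
  refine mul_le_of_le_one_left measureReal_nonneg (abs_le.2 ⟨?_, ?_⟩)
  · linarith [Real.sigmoid_nonneg x, Real.sigmoid_le_one y]
  · linarith [Real.sigmoid_nonneg y, Real.sigmoid_le_one x]

theorem continuous_recolorDiff (b : ℕ × Fin K → ℝ) : Continuous fun a => 𝒟.recolorDiff a b := by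
  refine continuous_tsum (fun c => ?_) 𝒟.summable_volume_cell
    fun c a => 𝒟.abs_sigmoid_sub_mul_le c _ _
  exact (((_root_.continuous_sigmoid.comp (continuous_apply c)).sub continuous_const).abs).mul
    continuous_const

theorem recolorDiff_self (a : ℕ × Fin K → ℝ) : 𝒟.recolorDiff a a = 0 := by
  simp [recolorDiff]

theorem recolorDiff_comm (a b : ℕ × Fin K → ℝ) : 𝒟.recolorDiff a b = 𝒟.recolorDiff b a := by
  simp only [recolorDiff, abs_sub_comm]

theorem volume_recolor_ne_le (g : MeasurableColoring d (K + 1)) (a b : ℕ × Fin K → ℝ) :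
    volume {x | (𝒟.recolor g a).color x ≠ (𝒟.recolor g b).color x} ≤
      ENNReal.ofReal (𝒟.recolorDiff a b) := by
  classical
  have hsub : {x | (𝒟.recolor g a).color x ≠ (𝒟.recolor g b).color x} ⊆
      ⋃ c, symmDiff (𝒟.part c (a c)) (𝒟.part c (b c)) := by
    intro x hx
    by_cases h : ∃ c, x ∈ 𝒟.cell c
    · obtain ⟨c, hc⟩ := h
      refine Set.mem_iUnion.2 ⟨c, ?_⟩
      by_contra hns
      refine hx ?_
      change 𝒟.recolorFun _ _ _ = 𝒟.recolorFun _ _ _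
      rw [𝒟.recolorFun_of_mem _ _ hc, 𝒟.recolorFun_of_mem _ _ hc]
      have hiff : x ∈ 𝒟.part c (a c) ↔ x ∈ 𝒟.part c (b c) := by
        rw [Set.mem_symmDiff] at hns
        tauto
      simp only [hiff]
    · rw [not_exists] at h
      refine absurd ?_ hx
      change 𝒟.recolorFun _ _ _ = 𝒟.recolorFun _ _ _
      rw [𝒟.recolorFun_of_notMem _ _ h, 𝒟.recolorFun_of_notMem _ _ h]
  refine (measure_mono hsub).trans ((measure_iUnion_le _).trans (le_of_eq ?_))
  rw [recolorDiff, ENNReal.ofReal_tsum_of_nonneg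
    (fun c => mul_nonneg (abs_nonneg _) measureReal_nonneg)
    (Summable.of_norm_bounded 𝒟.summable_volume_cell fun c => 𝒟.abs_sigmoid_sub_mul_le c _ _)]
  exact tsum_congr fun c => 𝒟.volume_symmDiff_part c _ _

theorem volume_inter_recolor_le (g : MeasurableColoring d (K + 1)) (a b : ℕ × Fin K → ℝ)
    {R : Set (Fin d → ℝ)} (hR : volume R ≠ ⊤) (j : Fin (K + 1)) :
    volume.real (R ∩ (𝒟.recolor g a).color ⁻¹' {j}) ≤
      volume.real (R ∩ (𝒟.recolor g b).color ⁻¹' {j}) + 𝒟.recolorDiff a b := by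
  have hnn : 0 ≤ 𝒟.recolorDiff a b := tsum_nonneg fun c => by positivity
  have hle := 𝒟.volume_recolor_ne_le g a b
  have h1 : volume (R ∩ (𝒟.recolor g b).color ⁻¹' {j}) ≠ ⊤ :=
    ne_top_of_le_ne_top hR (measure_mono Set.inter_subset_left)
  refine (measureReal_mono (s₂ := (R ∩ (𝒟.recolor g b).color ⁻¹' {j}) ∪
    {x | (𝒟.recolor g a).color x ≠ (𝒟.recolor g b).color x}) ?_ (measure_union_ne_top h1
      (ne_top_of_le_ne_top ENNReal.ofReal_ne_top hle))).trans
    ((measureReal_union_le _ _).trans (add_le_add_right ?_ _))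
  · rintro x ⟨hxR, hx⟩
    by_cases h : (𝒟.recolor g a).color x = (𝒟.recolor g b).color x
    · refine Or.inl ⟨hxR, ?_⟩
      rw [Set.mem_preimage, ← h]
      exact hx
    · exact Or.inr h
  · exact ENNReal.toReal_le_of_le_ofReal hnn hle

theorem dist_recolor_le (g : MeasurableColoring d (K + 1)) (a : ℕ × Fin K → ℝ) {ε : ℝ}
    (hε : 0 ≤ ε) (h𝒟 : ∑' c, volume (𝒟.cell c) ≤ ENNReal.ofReal ε) :
    dist (𝒟.recolor g a) g ≤ ε := by
  have hnorm : ∀ n, MeasurableColoring.normDist (𝒟.recolor g a) g (n + 1) ≤ ε := fun n => by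
    have h1 : volume.real (MeasurableColoring.diffSet (𝒟.recolor g a) g (n + 1)) ≤ ε := by
      refine ENNReal.toReal_le_of_le_ofReal hε (le_trans (measure_mono ?_)
        ((measure_iUnion_le 𝒟.cell).trans h𝒟))
      rintro x ⟨-, hx⟩
      by_contra h
      exact hx (𝒟.recolorFun_of_notMem _ _ fun c hc => h (Set.mem_iUnion.2 ⟨c, hc⟩))
    refine (div_le_self measureReal_nonneg (one_le_pow₀ ?_)).trans h1
    push_cast
    have : (0 : ℝ) ≤ n := n.cast_nonneg
    linarith
  have hgeom : HasSum (fun n : ℕ => ε / 2 ^ (n + 1)) ε := by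
    have h1 := (hasSum_geometric_two).mul_left (ε / 2)
    rw [div_mul_cancel₀ _ two_ne_zero] at h1
    refine h1.congr_fun fun n => ?_
    rw [one_div, inv_pow, pow_succ]
    field_simp
  change MeasurableColoring.colorDist _ _ ≤ ε
  unfold MeasurableColoring.colorDist
  rw [← hgeom.tsum_eq]
  exact (MeasurableColoring.summable_normDist _ _).tsum_le_tsum
    (fun n => div_le_div_of_nonneg_right (hnorm n) (by positivity)) hgeom.summable

end CellSystem

/-! ### Balanced parameters -/

/-- The parameters `p` are balanced for the coloring `f` if all labels receive the same amount of
each color. -/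
def Param.Balanced {d t q k : ℕ} (f : MeasurableColoring d k) (β : Fin t → SignType)
    (label : (Fin t → Bool) → Fin q) (p : Param d t) : Prop :=
  ∀ j l l', volume.real (Param.region β label p l ∩ f.color ⁻¹' {j}) =
    volume.real (Param.region β label p l' ∩ f.color ⁻¹' {j})

theorem measureReal_iUnion_fintype_of_nullMeasurableSet {X ι : Type*} [MeasurableSpace X]
    {μ : Measure X} [Fintype ι] {s : ι → Set X} (hd : Pairwise (Function.onFun Disjoint s))
    (hm : ∀ i, NullMeasurableSet (s i) μ) (hfin : ∀ i, μ (s i) ≠ ⊤) :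
    μ.real (⋃ i, s i) = ∑ i, μ.real (s i) := by
  rw [Measure.real, measure_iUnion₀ (fun i j hij => (hd hij).aedisjoint) hm, tsum_fintype,
    ENNReal.toReal_sum fun i _ => hfin i]
  rfl

namespace Param

variable {d t q k K Q : ℕ}

theorem Balanced.volume_region {f : MeasurableColoring d k} {β : Fin t → SignType}
    {label : (Fin t → Bool) → Fin q} {p : Param d t} (hf : Balanced f β label p)
    (hp : 0 < p.side) (l : Fin q) :
    volume.real (region β label p l) = (1 / q) * p.side ^ d := by
  have hq : (0 : ℝ) < q := by exact_mod_cast l.pos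
  have hcolor : ∀ l, volume.real (region β label p l) =
      ∑ j, volume.real (region β label p l ∩ f.color ⁻¹' {j}) := fun l => by
    rw [← measureReal_iUnion_fintype_of_nullMeasurableSet]
    · congr 1
      ext x
      simp
    · exact fun i j hij => Set.disjoint_left.2 fun x hx hx' => hij (hx.2.symm.trans hx'.2)
    · exact fun j => (measurableSet_region β label p l).nullMeasurableSet.inter
        (f.lebesgueMeasurable j)
    · exact fun j => ne_top_of_le_ne_top (volume_region_ne_top β label p l)
        (measure_mono Set.inter_subset_left)
  have heq : ∀ l', volume.real (region β label p l') = volume.real (region β label p l) :=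
    fun l' => by rw [hcolor, hcolor]; exact Finset.sum_congr rfl fun j _ => hf j l' l
  have hcube : volume.real (MeasurableColoring.cube p.corner p.side) = p.side ^ d := by
    rw [MeasurableColoring.cube, Measure.real, Real.volume_Icc_pi_toReal]
    · simp
    · exact fun j => by linarith
  rw [← iUnion_region β label p, measureReal_iUnion_fintype_of_nullMeasurableSet
    (pairwise_disjoint_region β label p)
    (fun l => (measurableSet_region β label p l).nullMeasurableSet)
    (volume_region_ne_top β label p), Finset.sum_congr rfl fun l' _ => heq l',
    Finset.sum_const, Finset.card_univ, Fintype.card_fin, nsmul_eq_mul] at hcube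
  rw [← hcube]
  field_simp

theorem Balanced.volume_region_ne_zero {f : MeasurableColoring d k} {β : Fin t → SignType}
    {label : (Fin t → Bool) → Fin q} {p : Param d t} (hf : Balanced f β label p)
    (hp : 0 < p.side) (l : Fin q) : volume (region β label p l) ≠ 0 := by
  have hq : (0 : ℝ) < q := by exact_mod_cast l.pos
  intro h
  have h1 := hf.volume_region hp l
  rw [Measure.real, h, ENNReal.toReal_zero] at h1
  exact absurd h1 (by positivity)

/-- The parameters of recolorings for which some point of `N` is balanced. -/
def badRecolorings (𝒟 : CellSystem d K) (g : MeasurableColoring d (K + 1)) (β : Fin t → SignType)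
    (label : (Fin t → Bool) → Fin q) (N : Set (Param d t)) : Set (ℕ × Fin K → ℝ) :=
  {a | ∃ p ∈ N, Balanced (𝒟.recolor g a) β label p}

/-- The set of bad parameters is the projection, along the compact set `N`, of the set of solutions
of equations that are continuous in both variables. -/
theorem isClosed_badRecolorings (𝒟 : CellSystem d K) (g : MeasurableColoring d (K + 1))
    (β : Fin t → SignType) (label : (Fin t → Bool) → Fin q) {N : Set (Param d t)}
    (hN : IsCompact N) {L : ℝ} (hL : ∀ p ∈ N, ∀ p' ∈ N, ∀ l,
      volume.real (region β label p l \ region β label p' l) ≤ L * dist p p') :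
    IsClosed (badRecolorings 𝒟 g β label N) := by
  have : CompactSpace N := isCompact_iff_compactSpace.1 hN
  have hcont : ∀ j l, Continuous fun z : N × (ℕ × Fin K → ℝ) =>
      volume.real (region β label z.1.1 l ∩ (𝒟.recolor g z.2).color ⁻¹' {j}) := fun j l => by
    rw [continuous_iff_continuousAt]
    intro z₀
    have hbound : ∀ z z' : N × (ℕ × Fin K → ℝ),
        volume.real (region β label z.1.1 l ∩ (𝒟.recolor g z.2).color ⁻¹' {j}) ≤
        volume.real (region β label z'.1.1 l ∩ (𝒟.recolor g z'.2).color ⁻¹' {j}) +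
          (L * dist z.1.1 z'.1.1 + 𝒟.recolorDiff z.2 z'.2) := fun z z' => by
      have h1 := volume_region_inter_le β label z.1.1 z'.1.1 l
        ((𝒟.recolor g z.2).color ⁻¹' {j})
      have h2 := 𝒟.volume_inter_recolor_le g z.2 z'.2
        (volume_region_ne_top β label z'.1.1 l) j
      have h3 := hL z.1.1 z.1.2 z'.1.1 z'.1.2 l
      linarith
    rw [ContinuousAt, tendsto_iff_dist_tendsto_zero]
    have hlim : Filter.Tendsto (fun z : N × (ℕ × Fin K → ℝ) =>
        L * dist z.1.1 z₀.1.1 + 𝒟.recolorDiff z.2 z₀.2) (nhds z₀) (nhds 0) := by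
      have hc : Continuous fun z : N × (ℕ × Fin K → ℝ) =>
          L * dist z.1.1 z₀.1.1 + 𝒟.recolorDiff z.2 z₀.2 :=
        (continuous_const.mul ((continuous_subtype_val.comp continuous_fst).dist
          continuous_const)).add ((𝒟.continuous_recolorDiff z₀.2).comp continuous_snd)
      have h0 := hc.tendsto z₀
      rwa [dist_self, mul_zero, 𝒟.recolorDiff_self, add_zero] at h0
    refine squeeze_zero (fun z => dist_nonneg) (fun z => ?_) hlim
    rw [Real.dist_eq, abs_le]
    have h1 := hbound z z₀
    have h2 := hbound z₀ z
    rw [dist_comm, 𝒟.recolorDiff_comm] at h2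
    constructor <;> linarith
  have hclosed : IsClosed {z : N × (ℕ × Fin K → ℝ) |
      Balanced (𝒟.recolor g z.2) β label z.1.1} := by
    simp only [Balanced, Set.ofPred_forall]
    exact isClosed_iInter fun j => isClosed_iInter fun l => isClosed_iInter fun l' =>
      isClosed_eq (hcont j l) (hcont j l')
  have himg : badRecolorings 𝒟 g β label N = Prod.snd '' {z : N × (ℕ × Fin K → ℝ) |
      Balanced (𝒟.recolor g z.2) β label z.1.1} := by
    ext a
    constructor
    · rintro ⟨p, hp, hb⟩
      exact ⟨(⟨p, hp⟩, a), hb, rfl⟩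
    · rintro ⟨⟨p, a⟩, hb, rfl⟩
      exact ⟨p.1, p.2, hb⟩
  rw [himg]
  exact isClosedMap_snd_of_compactSpace _ hclosed

theorem isOpenMap_sigmoid : IsOpenMap Real.sigmoid := by
  have h1 : Topology.IsEmbedding Real.sigmoid :=
    Real.sigmoid_strictMono.isEmbedding_of_ordConnected
      (by rw [Real.range_sigmoid]; exact Set.ordConnected_Ioo)
  exact (Topology.IsOpenEmbedding.mk h1 (by rw [Real.range_sigmoid]; exact isOpen_Ioo)).isOpenMap

/-- The colors `j` in a region `R` after recoloring, where the parameters of the cells `c l j` are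
`X l j` and those of all other cells are given by `a`. If `R` contains the cells `c l j` for a
single `l` and meets none of the others, only the cell `c l j` contributes a part that depends
on `X`. -/
theorem volume_inter_recolor_extend (𝒟 : CellSystem d K) (g : MeasurableColoring d (K + 1))
    {i : Fin Q → ℕ} (hi : Function.Injective i) (a : ℕ × Fin K → ℝ) (X : Fin Q × Fin K → ℝ)
    {R : Set (Fin d → ℝ)} (hRfin : volume R ≠ ⊤) (j : Fin K)
    (s : Option (Fin Q)) (hin : ∀ l ∈ s, ∀ j', 𝒟.cell (i l, j') ⊆ R)
    (hout : ∀ l ∉ s, ∀ j', Disjoint (𝒟.cell (i l, j')) R) :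
    volume.real (R ∩ (𝒟.recolor g (Function.extend (fun m : Fin Q × Fin K => (i m.1, m.2)) X
        a)).color ⁻¹' {j.castSucc}) =
      (s.elim 0 fun l => Real.sigmoid (X (l, j)) * volume.real (𝒟.cell (i l, j))) +
        volume.real (R ∩ ((𝒟.recolor g a).color ⁻¹' {j.castSucc} \
          ⋃ m : Fin Q × Fin K, 𝒟.cell (i m.1, m.2))) := by
  classical
  set e : Fin Q × Fin K → ℕ × Fin K := fun m => (i m.1, m.2) with he
  have hinj : Function.Injective e := fun m m' h =>
    Prod.ext (hi (congrArg Prod.fst h)) (congrArg Prod.snd h : _)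
  set b := Function.extend e X a with hb
  have hbe : ∀ m, b (e m) = X m := fun m => hinj.extend_apply _ _ _
  set C := ⋃ m : Fin Q × Fin K, 𝒟.cell (i m.1, m.2) with hC
  have hCm : MeasurableSet C := MeasurableSet.iUnion fun m => 𝒟.measurableSet_cell _
  have hfin : volume (R ∩ (𝒟.recolor g b).color ⁻¹' {j.castSucc}) ≠ ⊤ :=
    ne_top_of_le_ne_top hRfin (measure_mono Set.inter_subset_left)
  rw [← measureReal_inter_add_sdiff hCm hfin]
  congr 1
  · have hset : R ∩ (𝒟.recolor g b).color ⁻¹' {j.castSucc} ∩ C =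
        s.elim ∅ fun l => 𝒟.part (i l, j) (X (l, j)) := by
      ext x
      constructor
      · rintro ⟨⟨hxR, hxj⟩, hxC⟩
        obtain ⟨⟨l, j'⟩, hx⟩ := Set.mem_iUnion.1 hxC
        have hls : l ∈ s := by
          by_contra hls
          exact Set.disjoint_left.1 (hout l hls j') hx hxR
        have hcol : 𝒟.recolorFun g.color b x = j.castSucc := hxj
        rw [𝒟.recolorFun_of_mem _ _ hx] at hcol
        split_ifs at hcol with hpart
        · have hj : j' = j := Fin.castSucc_injective _ hcol
          subst hj
          rw [hbe (l, j')] at hpart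
          rw [Option.mem_def.1 hls]
          exact hpart
        · exact absurd hcol.symm (Fin.castSucc_lt_last j).ne
      · intro hx
        cases s with
        | none => exact hx.elim
        | some l =>
          have hxc : x ∈ 𝒟.cell (i l, j) := 𝒟.part_subset _ _ hx
          refine ⟨⟨hin l rfl j hxc, ?_⟩, Set.mem_iUnion.2 ⟨(l, j), hxc⟩⟩
          change 𝒟.recolorFun g.color b x = j.castSucc
          rw [𝒟.recolorFun_of_mem _ _ hxc, hbe (l, j)]
          exact if_pos hx
    rw [hset]
    cases s with
    | none => simp
    | some l => exact 𝒟.volume_part _ _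
  · congr 1
    ext x
    have hcol : x ∉ C → (𝒟.recolor g b).color x = (𝒟.recolor g a).color x := fun hxC => by
      change 𝒟.recolorFun _ _ _ = 𝒟.recolorFun _ _ _
      by_cases hx : ∃ c, x ∈ 𝒟.cell c
      · obtain ⟨c, hc⟩ := hx
        have hce : ¬ ∃ m, e m = c := by
          rintro ⟨m, rfl⟩
          exact hxC (Set.mem_iUnion.2 ⟨m, hc⟩)
        rw [𝒟.recolorFun_of_mem _ _ hc, 𝒟.recolorFun_of_mem _ _ hc, hb,
          Function.extend_apply' _ _ _ hce]
      · rw [not_exists] at hx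
        rw [𝒟.recolorFun_of_notMem _ _ hx, 𝒟.recolorFun_of_notMem _ _ hx]
    constructor
    · rintro ⟨⟨hxR, hx⟩, hxC⟩
      refine ⟨hxR, ?_, hxC⟩
      rw [Set.mem_preimage, ← hcol hxC]
      exact hx
    · rintro ⟨hxR, hx, hxC⟩
      refine ⟨⟨hxR, ?_⟩, hxC⟩
      rw [Set.mem_preimage, hcol hxC]
      exact hx

end Param

/-! ### Balancedness is a nowhere dense condition -/

namespace Param

variable {d t q k K Q : ℕ}

open scoped NNReal in
/-- A Lipschitz map from `ℝ^m` to `ℝ^n` with `m ≤ n` maps null sets to null sets. -/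
theorem volume_image_eq_zero_of_lipschitzOnWith {ι κ : Type*} [Fintype ι] [Fintype κ]
    (hcard : Fintype.card ι ≤ Fintype.card κ) {C : ℝ≥0} {f : (ι → ℝ) → κ → ℝ} {s : Set (ι → ℝ)}
    (hf : LipschitzOnWith C f s) (hs : volume s = 0) : volume (f '' s) = 0 := by
  have h1 : Measure.hausdorffMeasure (Fintype.card κ : ℝ) s = 0 := by
    refine le_antisymm ((Measure.hausdorffMeasure_mono (Nat.cast_le.2 hcard) s).trans ?_)
      zero_le
    rw [hausdorffMeasure_pi_real, hs]
  rw [← hausdorffMeasure_pi_real (ι := κ)]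
  refine le_antisymm ((hf.hausdorffMeasure_image_le (Nat.cast_nonneg _)).trans ?_) zero_le
  rw [h1, mul_zero]

/-- If the recoloring with parameters `X` in the cells `(i l, j)` is balanced at `p`, then the
sizes of the selected parts of these cells are determined by `p`. As `p` ranges over a null set of
dimension at most `Q * K`, this fails for some `X` in every open set. -/
theorem interior_badRecolorings_eq_empty (𝒟 : CellSystem d K) (g : MeasurableColoring d (K + 1))
    (β : Fin t → SignType) (label : (Fin t → Bool) → Fin (Q + 1)) (hQ : 0 < Q)
    (hdim : t * d + d + 1 ≤ Q * K) {N : Set (Param d t)} (hNpos : ∀ p ∈ N, 0 < p.side)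
    {L : ℝ} (hL0 : 0 ≤ L) (hL : ∀ p ∈ N, ∀ p' ∈ N, ∀ l,
      volume.real (region β label p l \ region β label p' l) ≤ L * dist p p')
    {i : Fin Q → ℕ} (hi : Function.Injective i)
    (hcell : ∀ p ∈ N, ∀ l j, 𝒟.cell (i l, j) ⊆ region β label p l.succ) :
    interior (badRecolorings 𝒟 g β label N) = ∅ := by
  by_contra hne
  obtain ⟨a, ha⟩ := Set.nonempty_iff_ne_empty.2 hne
  set e : Fin Q × Fin K → ℕ × Fin K := fun m => (i m.1, m.2) with he
  have hinj : Function.Injective e := fun m m' h =>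
    Prod.ext (hi (congrArg Prod.fst h)) (congrArg Prod.snd h : _)
  set upd : (Fin Q × Fin K → ℝ) → (ℕ × Fin K → ℝ) := fun X => Function.extend e X a with hupd
  have hupdc : Continuous upd := by
    refine continuous_pi fun c => ?_
    by_cases hc : ∃ m, e m = c
    · obtain ⟨m, rfl⟩ := hc
      simp only [hupd, hinj.extend_apply]
      exact continuous_apply m
    · simp only [hupd, Function.extend_apply' _ _ _ hc]
      exact continuous_const
  set W := upd ⁻¹' interior (badRecolorings 𝒟 g β label N) with hW
  have hWo : IsOpen W := isOpen_interior.preimage hupdc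
  have hWne : W.Nonempty := by
    refine ⟨fun m => a (e m), ?_⟩
    have : upd (fun m => a (e m)) = a := by
      funext c
      by_cases hc : ∃ m, e m = c
      · obtain ⟨m, rfl⟩ := hc
        simp only [hupd, hinj.extend_apply]
      · simp only [hupd, Function.extend_apply' _ _ _ hc]
    rwa [hW, Set.mem_preimage, this]
  -- the amount of color `j` that label `0` receives more than label `l`, outside the chosen cells
  set E : Fin K → Set (Fin d → ℝ) := fun j => (𝒟.recolor g a).color ⁻¹' {j.castSucc} \
    ⋃ m : Fin Q × Fin K, 𝒟.cell (i m.1, m.2) with hE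
  set Φ : Param d t → Fin Q × Fin K → ℝ := fun p m =>
    volume.real (region β label p 0 ∩ E m.2) -
      volume.real (region β label p m.1.succ ∩ E m.2) with hΦ
  set Ψ : (Fin Q × Fin K → ℝ) → Fin Q × Fin K → ℝ :=
    Pi.map fun m x => Real.sigmoid x * volume.real (𝒟.cell (e m)) with hΨ
  set S : Set (Param d t) := N ∩ {p | 0 < p.side ∧
    volume.real (region β label p 0) = (1 / ((Q + 1 : ℕ) : ℝ)) * p.side ^ d} with hS
  have hSnull : volume S = 0 := by
    refine measure_mono_null Set.inter_subset_right
      (volume_setOf_region_share_eq_zero β label 0 (by positivity) ?_)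
    rw [div_lt_one (by positivity)]
    exact_mod_cast Nat.succ_lt_succ hQ
  have hout : ∀ p ∈ N, ∀ l j l', l' ≠ l.succ →
      Disjoint (𝒟.cell (i l, j)) (region β label p l') := fun p hp l j l' hl =>
    (pairwise_disjoint_region β label p hl.symm).mono_left (hcell p hp l j)
  have hsub : Ψ '' W ⊆ Φ '' S := by
    rintro _ ⟨X, hX, rfl⟩
    obtain ⟨p, hp, hb⟩ := interior_subset hX
    refine ⟨p, ⟨hp, hNpos p hp, hb.volume_region (hNpos p hp) 0⟩, ?_⟩
    funext ⟨l, j⟩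
    have h0 := volume_inter_recolor_extend 𝒟 g hi a X (R := region β label p 0)
      (volume_region_ne_top β label p 0) j none (fun l hl => by simp at hl)
      (fun l _ j' => hout p hp l j' 0 (Fin.succ_ne_zero l).symm)
    have h1 := volume_inter_recolor_extend 𝒟 g hi a X (R := region β label p l.succ)
      (volume_region_ne_top β label p l.succ) j (some l)
      (fun l' hl' j' => by
        rw [Option.mem_some_iff.1 hl']
        exact hcell p hp l' j')
      (fun l' hl' j' => hout p hp l' j' l.succ fun h =>
        hl' (Option.mem_some_iff.2 (Fin.succ_injective _ h)))
    have h2 := hb j.castSucc 0 l.succ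
    simp only [Option.elim_none, Option.elim_some, zero_add] at h0 h1
    simp only [hΦ, hΨ, Pi.map_apply]
    rw [sub_eq_iff_eq_add]
    exact h0.symm.trans (h2.trans h1)
  have hlip : LipschitzOnWith (2 * L).toNNReal Φ S := by
    refine LipschitzOnWith.of_dist_le_mul fun p hp p' hp' => ?_
    refine (dist_pi_le_iff (mul_nonneg (NNReal.coe_nonneg _) dist_nonneg)).2 fun m => ?_
    have hle : ∀ l, |volume.real (region β label p l ∩ E m.2) -
        volume.real (region β label p' l ∩ E m.2)| ≤ L * dist p p' := fun l => by
      have h1 := volume_region_inter_le β label p p' l (E m.2)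
      have h2 := volume_region_inter_le β label p' p l (E m.2)
      have h3 := hL p hp.1 p' hp'.1 l
      have h4 := hL p' hp'.1 p hp.1 l
      rw [dist_comm] at h4
      rw [abs_le]
      constructor <;> linarith
    have h0 := abs_le.1 (hle 0)
    have h1 := abs_le.1 (hle m.1.succ)
    rw [Real.dist_eq, Real.coe_toNNReal _ (by positivity), abs_le]
    simp only [hΦ]
    constructor <;> linarith
  have hcard : Fintype.card (ParamIndex d t) ≤ Fintype.card (Fin Q × Fin K) := by
    simp only [ParamIndex, Fintype.card_sum, Fintype.card_prod, Fintype.card_fin,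
      Fintype.card_unit]
    omega
  have hopen : IsOpen (Ψ '' W) := by
    refine IsOpenMap.piMap (fun m => ?_) (by simp) W hWo
    exact (Homeomorph.mulRight₀ _ (𝒟.volume_real_cell_pos (e m)).ne').isOpenMap.comp
      isOpenMap_sigmoid
  exact (hopen.measure_pos volume (hWne.image Ψ)).ne'
    (measure_mono_null hsub (volume_image_eq_zero_of_lipschitzOnWith hcard hlip hSnull))

/-- Around parameters for which all regions have positive volume, balancedness is a nowhere dense
condition on the recoloring. -/
theorem exists_nhds_isNowhereDense_badRecolorings (𝒟 : CellSystem d K) {U : ℕ → Set (Fin d → ℝ)}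
    (hU : ∀ O : Set (Fin d → ℝ), IsOpen O → O.Nonempty → ∃ n, U n ⊆ O)
    (h𝒟 : ∀ c, 𝒟.cell c ⊆ U c.1) (g : MeasurableColoring d (K + 1))
    (β : Fin t → SignType) (label : (Fin t → Bool) → Fin (Q + 1)) (hQ : 0 < Q)
    (hdim : t * d + d + 1 ≤ Q * K) {p₀ : Param d t} (hp₀ : p₀ ∈ admissible d t)
    (hpos : ∀ l, volume (region β label p₀ l) ≠ 0) :
    ∃ N ∈ nhds p₀, IsNowhereDense (badRecolorings 𝒟 g β label N) := by
  obtain ⟨ρ, hρ, L, hL0, hL⟩ := exists_lipschitz_region β label hp₀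
  choose O hOo hOne hO using fun l => exists_open_subset_region β label hp₀ (hpos l)
  choose i hi using fun l : Fin Q => hU (O l.succ) (hOo _) (hOne _)
  have hside : ∀ᶠ p : Param d t in nhds p₀, 0 < p.side :=
    continuous_side.continuousAt.eventually (lt_mem_nhds hp₀.1)
  obtain ⟨ρ', hρ', hball⟩ := Metric.nhds_basis_closedBall.eventually_iff.1
    ((hside.and (Filter.eventually_all.2 hO)).and (Metric.closedBall_mem_nhds p₀ hρ))
  have hL' : ∀ p ∈ Metric.closedBall p₀ ρ', ∀ p' ∈ Metric.closedBall p₀ ρ', ∀ l,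
      volume.real (region β label p l \ region β label p' l) ≤ L * dist p p' :=
    fun p hp p' hp' l => hL p (hball hp).2 p' (hball hp').2 l
  have hcell : ∀ p ∈ Metric.closedBall p₀ ρ', ∀ l j,
      𝒟.cell (i l, j) ⊆ region β label p l.succ := fun p hp l j =>
    (h𝒟 _).trans ((hi l).trans ((hball hp).1.2 l.succ))
  have hK : 0 < K := Nat.pos_of_ne_zero fun h => by subst h; omega
  have hinj : Function.Injective i := fun l l' hll => by
    by_contra hne
    have h1 := hcell p₀ (Metric.mem_closedBall_self hρ'.le) l ⟨0, hK⟩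
    have h2 := hcell p₀ (Metric.mem_closedBall_self hρ'.le) l' ⟨0, hK⟩
    rw [← hll] at h2
    obtain ⟨x, hx⟩ := nonempty_of_measure_ne_zero (𝒟.volume_cell_ne_zero (i l, ⟨0, hK⟩))
    exact Set.disjoint_left.1 (pairwise_disjoint_region β label p₀
      fun h => hne (Fin.succ_injective _ h)) (h1 hx) (h2 hx)
  refine ⟨Metric.closedBall p₀ ρ', Metric.closedBall_mem_nhds p₀ hρ', ?_⟩
  rw [(isClosed_badRecolorings 𝒟 g β label (isCompact_closedBall p₀ ρ') hL').isNowhereDense_iff]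
  exact interior_badRecolorings_eq_empty 𝒟 g β label hQ hdim (fun p hp => (hball hp).1.1) hL0 hL'
    hinj hcell

/-- Some recoloring has no balanced parameters at all: countably many neighborhoods as in
`exists_nhds_isNowhereDense_badRecolorings` suffice to cover all candidates. -/
theorem exists_recolor_forall_not_balanced (𝒟 : CellSystem d K) {U : ℕ → Set (Fin d → ℝ)}
    (hU : ∀ O : Set (Fin d → ℝ), IsOpen O → O.Nonempty → ∃ n, U n ⊆ O)
    (h𝒟 : ∀ c, 𝒟.cell c ⊆ U c.1) (g : MeasurableColoring d (K + 1)) (hQ : 0 < Q)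
    (hdim : t * d + d + 1 ≤ Q * K) :
    ∃ a, ∀ (β : Fin t → SignType) (label : (Fin t → Bool) → Fin (Q + 1)),
      ∀ p ∈ admissible d t, ¬ Balanced (𝒟.recolor g a) β label p := by
  have hmeagre : ∀ (β : Fin t → SignType) (label : (Fin t → Bool) → Fin (Q + 1)),
      IsMeagre (badRecolorings 𝒟 g β label (admissible d t)) := fun β label => by
    have hloc : ∀ p ∈ {p | p ∈ admissible d t ∧ ∀ l, volume (region β label p l) ≠ 0},
        ∃ N ∈ nhds p, IsNowhereDense (badRecolorings 𝒟 g β label N) := fun p hp =>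
      exists_nhds_isNowhereDense_badRecolorings 𝒟 hU h𝒟 g β label hQ hdim hp.1 hp.2
    choose! N hN hNbad using hloc
    obtain ⟨T, hT, hTc, hcov⟩ := TopologicalSpace.countable_cover_nhdsWithin
      fun p hp => mem_nhdsWithin_of_mem_nhds (hN p hp)
    refine (isMeagre_biUnion hTc fun p hp => (hNbad p (hT hp)).isMeagre).mono ?_
    rintro a ⟨p, hp, hb⟩
    obtain ⟨p', hp', hpp'⟩ := Set.mem_iUnion₂.1 (hcov ⟨hp, hb.volume_region_ne_zero hp.1⟩)
    exact Set.mem_iUnion₂.2 ⟨p', hp', p, hpp', hb⟩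
  have hall := isMeagre_iUnion fun β => isMeagre_iUnion fun label => hmeagre β label
  obtain ⟨a, ha⟩ := (dense_of_mem_residual hall).nonempty
  refine ⟨a, fun β label p hp hb => ha ?_⟩
  exact Set.mem_iUnion.2 ⟨β, Set.mem_iUnion.2 ⟨label, p, hp, hb⟩⟩

end Param

/-! ### From fair splittings to balanced parameters -/

namespace MeasurableColoring

variable {d k q t : ℕ}

/-- Every hyperplane has an equation `V ⬝ (x - α) = β * r` with `β ∈ {-1, 0, 1}`, whose two sides
correspond to those of the given equation. -/
theorem exists_normalized_hyperplane {v : Fin d → ℝ} (hv : v ≠ 0) (b : ℝ) (α : Fin d → ℝ) {r : ℝ}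
    (hr : 0 < r) :
    ∃ (V : Fin d → ℝ) (β : SignType) (m : ℝ), 0 < m ∧ (∃ j, V j ≠ 0) ∧
      ∀ x : Fin d → ℝ, ∑ j, V j * (x j - α j) - (β : ℝ) * r = m * (v ⬝ᵥ x - b) := by
  obtain ⟨j, hj⟩ := Function.ne_iff.1 hv
  obtain ⟨m, hm, hmb⟩ : ∃ m : ℝ, 0 < m ∧
      ((SignType.sign (b - v ⬝ᵥ α) : SignType) : ℝ) * r = m * (b - v ⬝ᵥ α) := by
    by_cases hb : b - v ⬝ᵥ α = 0
    · exact ⟨1, one_pos, by simp [hb]⟩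
    · have hpos := abs_pos.2 hb
      refine ⟨r / |b - v ⬝ᵥ α|, div_pos hr hpos, ?_⟩
      have h1 := sign_mul_abs (b - v ⬝ᵥ α)
      rw [div_mul_eq_mul_div, eq_div_iff hpos.ne']
      calc _ = r * (((SignType.sign (b - v ⬝ᵥ α) : SignType) : ℝ) * |b - v ⬝ᵥ α|) := by ring
        _ = _ := by rw [h1]
  refine ⟨fun j => m * v j, SignType.sign (b - v ⬝ᵥ α), m, hm, ⟨j, mul_ne_zero hm.ne' hj⟩,
    fun x => ?_⟩
  rw [hmb]
  have h1 : ∑ j, m * v j * (x j - α j) = m * (v ⬝ᵥ x - v ⬝ᵥ α) := by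
    simp only [dotProduct, ← Finset.sum_sub_distrib, Finset.mul_sum]
    exact Finset.sum_congr rfl fun j _ => by ring
  rw [h1]
  ring

theorem HasFairSplitting.exists_balanced (hd : 0 < d) {f : MeasurableColoring d k}
    {α : Fin d → ℝ} {r : ℝ} (hr : 0 < r) (h : f.HasFairSplitting q t (cube α r)) :
    ∃ (β : Fin t → SignType) (label : (Fin t → Bool) → Fin q), ∃ p ∈ Param.admissible d t,
      Param.Balanced f β label p := by
  obtain ⟨s, hst, v, b, hv, lab, hfair⟩ := h
  choose V β m hm hV hform using fun i => exists_normalized_hyperplane (hv i) (b i) α hr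
  -- `t - s` further hyperplanes with all coefficients `1` are added, which the labeling ignores
  set p : Param d t := Sum.elim (Sum.elim (fun _ => r) α)
    (fun z => if hz : z.1.1 < s then V ⟨z.1.1, hz⟩ z.2 else 1) with hp
  set β' : Fin t → SignType := fun i => if hi : i.1 < s then β ⟨i.1, hi⟩ else 0 with hβ'
  have hcut : ∀ (i : Fin s) (x : Fin d → ℝ),
      Param.cutForm β' p (Fin.castLE hst i) x = m i * (v i ⬝ᵥ x - b i) := fun i x => by
    rw [← hform i x]
    simp [Param.cutForm, Param.normal, Param.corner, Param.side, hp, hβ']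
  have hadm : p ∈ Param.admissible d t := by
    refine ⟨hr, fun i => ?_⟩
    by_cases hi : i.1 < s
    · obtain ⟨j, hj⟩ := hV ⟨i.1, hi⟩
      refine ⟨j, ?_⟩
      simpa [Param.normal, hp, hi] using hj
    · exact ⟨⟨0, hd⟩, by simp [Param.normal, hp, hi]⟩
  set label : (Fin t → Bool) → Fin q := fun σ => lab fun i => σ (Fin.castLE hst i) with hlabel
  have hcube : cube p.corner p.side = cube α r := rfl
  have hsigns : ∀ (i : Fin s) (x : Fin d → ℝ),
      Param.signs β' p x (Fin.castLE hst i) = decide (b i < v i ⬝ᵥ x) := fun i x => by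
    rw [Param.signs, decide_eq_decide, hcut, mul_pos_iff_of_pos_left (hm i), sub_pos]
  have hpieces : ∀ (l : Fin q) (E : Set (Fin d → ℝ)),
      volume ((⋃ σ ∈ {σ | lab σ = l}, hyperplanePiece (cube α r) v b σ) ∩ E) =
        volume (Param.region β' label p l ∩ E) := fun l E => by
    refine le_antisymm (measure_mono (Set.inter_subset_inter_left _ ?_)) ?_
    · intro x hx
      obtain ⟨σ, hσ, hxC, hxσ⟩ := Set.mem_iUnion₂.1 hx
      refine ⟨hxC, ?_⟩
      have : (fun i => Param.signs β' p x (Fin.castLE hst i)) = σ := by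
        funext i
        rw [hsigns]
        have h1 := hxσ i
        cases hi : σ i with
        | true => simpa [hi] using h1
        | false =>
          rw [hi] at h1
          simp only [Bool.false_eq_true, if_false] at h1
          simpa using h1.le
      simp only [hlabel, this]
      exact hσ
    · have hnull := Param.volume_nearWalls_zero β' hadm (2 * ‖p‖) (by positivity)
      refine (measure_mono (t := ((⋃ σ ∈ {σ | lab σ = l},
        hyperplanePiece (cube α r) v b σ) ∩ E) ∪ Param.nearWalls β' p (2 * ‖p‖) 0) ?_).trans
          ((measure_union_le _ _).trans (by rw [hnull, add_zero]))
      rintro x ⟨⟨hxC, hxl⟩, hxE⟩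
      by_cases hw : ∃ i, v i ⬝ᵥ x = b i
      · obtain ⟨i, hi⟩ := hw
        refine Or.inr ⟨fun j => Param.abs_le_of_mem_cube le_rfl hxC j,
          Or.inr (Or.inr ⟨Fin.castLE hst i, ?_⟩)⟩
        rw [hcut, hi]
        simp
      · rw [not_exists] at hw
        refine Or.inl ⟨Set.mem_iUnion₂.2 ⟨fun i => decide (b i < v i ⬝ᵥ x), ?_, hxC, fun i => ?_⟩,
          hxE⟩
        · rw [Set.mem_ofPred_eq, ← hxl]
          simp only [hlabel, hsigns]
        · by_cases hi : b i < v i ⬝ᵥ x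
          · simp [hi]
          · have := lt_of_le_of_ne (not_lt.1 hi) (hw i)
            simpa [hi] using this
  refine ⟨β', label, p, hadm, fun j l l' => ?_⟩
  rw [Measure.real, Measure.real, ← hpieces, ← hpieces, hfair, hfair]

/-! ### Colorings at distance zero -/

theorem ae_eq_of_dist_eq_zero {f g : MeasurableColoring d k} (h : dist f g = 0) :
    f.color =ᵐ[volume] g.color := by
  have hsum : HasSum (fun n => normDist f g (n + 1) / 2 ^ (n + 1)) 0 := by
    rw [← show colorDist f g = 0 from h]
    exact (summable_normDist f g).hasSum
  have hterm := (hasSum_zero_iff_of_nonneg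
    fun n => div_nonneg (normDist_nonneg f g (n + 1)) (by positivity)).1 hsum
  have hnull : ∀ n : ℕ, volume (diffSet f g (n + 1)) = 0 := fun n => by
    have h1 := congrFun hterm n
    rw [Pi.zero_apply] at h1
    have hpow : (2 : ℝ) ^ (n + 1) ≠ 0 := by positivity
    have hbox : (2 * ((n + 1 : ℕ) : ℝ)) ^ d ≠ 0 := by positivity
    rw [div_eq_zero_iff, or_iff_left hpow, normDist, div_eq_zero_iff, or_iff_left hbox] at h1
    exact (measureReal_eq_zero_iff (volume_diffSet_ne_top f g _)).1 h1
  refine measure_mono_null ?_ (measure_iUnion_null hnull)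
  intro x hx
  obtain ⟨n, hn⟩ := exists_nat_ge ‖x‖
  refine Set.mem_iUnion.2 ⟨n, ⟨fun i => ?_, fun i => ?_⟩, hx⟩
  all_goals
    have h1 := norm_le_pi_norm x i
    rw [Real.norm_eq_abs] at h1
    have h2 := abs_le.1 (h1.trans hn)
    push_cast
    linarith

theorem AvoidsFairSplitting.congr {f g : MeasurableColoring d k} (h : f.color =ᵐ[volume] g.color)
    (hf : f.AvoidsFairSplitting q t) : g.AvoidsFairSplitting q t := by
  have hvol : ∀ (A : Set (Fin d → ℝ)) (j : Fin k),
      volume (A ∩ g.color ⁻¹' {j}) = volume (A ∩ f.color ⁻¹' {j}) := fun A j =>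
    measure_congr <| by
      filter_upwards [h] with x hx
      refine propext (and_congr_right fun _ => ?_)
      simp only [Set.mem_preimage, hx]
  rintro α r hr ⟨s, hs, v, b, hv, label, hlab⟩
  refine hf α r hr ⟨s, hs, v, b, hv, label, fun j l => ?_⟩
  rw [← hvol, ← hvol]
  exact hlab j l

/-! ### Density of the colorings without fair splittings -/

theorem dense_setOf_avoidsFairSplitting {K Q : ℕ} (hd : 0 < d) (hQ : 0 < Q)
    (hdim : t * d + d + 1 ≤ Q * K) :
    Dense {f : MeasurableColoring d (K + 1) | f.AvoidsFairSplitting (Q + 1) t} := by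
  refine Metric.dense_iff.2 fun g ε hε => ?_
  have hbasis := TopologicalSpace.isBasis_countableBasis (Fin d → ℝ)
  obtain ⟨B, hB, -⟩ := hbasis.exists_nonempty_subset (u := Set.univ) Set.univ_nonempty isOpen_univ
  obtain ⟨U, hU⟩ := (TopologicalSpace.countable_countableBasis (Fin d → ℝ)).exists_eq_range
    ⟨B, hB⟩
  have hUmem : ∀ n, U n ∈ TopologicalSpace.countableBasis (Fin d → ℝ) := fun n =>
    hU ▸ Set.mem_range_self n
  have hUsub : ∀ O : Set (Fin d → ℝ), IsOpen O → O.Nonempty → ∃ n, U n ⊆ O := fun O hO hne => by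
    obtain ⟨B', hB', -, hsub⟩ := hbasis.exists_nonempty_subset hne hO
    rw [hU] at hB'
    obtain ⟨n, rfl⟩ := hB'
    exact ⟨n, hsub⟩
  obtain ⟨𝒟, h𝒟U, h𝒟ε⟩ := CellSystem.exists_subset_of_isOpen (K := K) hd
    (fun n => TopologicalSpace.isOpen_of_mem_countableBasis (hUmem n))
    (fun n => TopologicalSpace.nonempty_of_mem_countableBasis (hUmem n)) (half_pos hε)
  obtain ⟨a, ha⟩ := Param.exists_recolor_forall_not_balanced (t := t) 𝒟 hUsub h𝒟U g hQ hdim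
  refine ⟨𝒟.recolor g a, ?_, fun α r hr hfair => ?_⟩
  · exact (𝒟.dist_recolor_le g a (half_pos hε).le h𝒟ε).trans_lt (half_lt_self hε)
  · obtain ⟨β, label, p, hp, hb⟩ := hfair.exists_balanced hd hr
    exact ha β label p hp hb

end MeasurableColoring

theorem mainTheorem8 (d k t q : ℕ) (hd : 1 ≤ d) (hk : 1 ≤ k) (ht : 1 ≤ t) (hq : 2 ≤ q)
    (h : k * (q - 1) > d * t + d + q - 1) :
    (∃ f : MeasurableColoring d k, f.AvoidsFairSplitting q t) ∧
      Dense {c : ColoringSpace d k |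
        ∀ f : MeasurableColoring d k, SeparationQuotient.mk f = c →
          f.AvoidsFairSplitting q t} := by
  obtain ⟨K, rfl⟩ : ∃ K, k = K + 1 := ⟨k - 1, by omega⟩
  obtain ⟨Q, rfl⟩ : ∃ Q, q = Q + 1 := ⟨q - 1, by omega⟩
  have hdim : t * d + d + 1 ≤ Q * K := by
    rw [Nat.add_sub_cancel, add_mul, one_mul, mul_comm K Q, mul_comm d t] at h
    omega
  have hdense := MeasurableColoring.dense_setOf_avoidsFairSplitting (t := t) (K := K) (Q := Q)
    (by omega : 0 < d) (by omega) hdim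
  constructor
  · have hne : Nonempty (MeasurableColoring d (K + 1)) :=
      ⟨⟨fun _ => 0, fun j => (measurableSet_preimage measurable_const
        (measurableSet_singleton j)).nullMeasurableSet⟩⟩
    exact hdense.nonempty
  · refine (SeparationQuotient.surjective_mk.denseRange.dense_image
      SeparationQuotient.continuous_mk hdense).mono ?_
    rintro _ ⟨f, hf, rfl⟩ g hg
    exact MeasurableColoring.AvoidsFairSplitting.congr
      (MeasurableColoring.ae_eq_of_dist_eq_zero
        (Metric.inseparable_iff.1 (SeparationQuotient.mk_eq_mk.1 hg.symm))) hf
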